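/- **Theorem 2.1.** Let $p,q\ge 0$ be integers, let $0<\underline u<\bar u$, $0<\rho_0<1$, $q\underline u<\rho_0$, and let $$\Theta=\{(s_0,\dots,s_p,t_1,\dots,t_q)\in\mathbb R^{p+q+1}:\ t_1+\dots+t_q\le\rho_0,\ \underline u\le s_i\le\bar u,\ \underline u\le t_j\le\bar u \text{ for all } i,j\}.$$ Let $\boldsymbol\theta=(\alpha_0,\alpha_1,\dots,\alpha_p,\beta_1,\dots,\beta_q)$ lie in the interior of $\Theta$, let $(\varepsilon_t)_{t\in\mathbb Z}$ be i.i.d. random variables with mean $0$ and variance $1$, and let $(X_t,\sigma_t)_{t\in\mathbb Z}$, $\sigma_t\ge 0$, be a strictly stationary solution of the GARCH$(p,q)$ equations $$X_t=\sigma_t\varepsilon_t,\qquad \sigma_t^2=\alpha_0+\sum_{i=1}^p\alpha_iX_{t-i}^2+\sum_{j=1}^q\beta_j\sigma_{t-j}^2,$$ under the Bougerol–Picard stationarity condition that the top Lyapunov exponent of the model is negative: $\inf_{m\ge1}\frac1m E\log\|A(\varepsilon_0)A(\varepsilon_{-1})\cdots A(\varepsilon_{-(m-1)})\|<0$, where $A(\varepsilon_t)$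 is the random matrix in the vector recursion $Y_t=A(\varepsilon_t)Y_{t-1}+b(\varepsilon_t)$ satisfied by $Y_t=(X_t^2,\dots,X_{t-p+1}^2,\sigma_t^2,\dots,\sigma_{t-q+1}^2)$. For $\mathbf u=(s_0,\dots,s_p,t_1,\dots,t_q)$ put $c_0(\mathbf u)=s_0/(1-(t_1+\dots+t_q))$ and, for $i\ge1$, $c_i(\mathbf u)=s_i+\sum_{1\le j\le\min(q,i-1)}t_jc_{i-j}(\mathbf u)$, with $s_i=0$ for $i>p$. Let $\hat{\boldsymbol\theta}_n$ be random vectors in $\mathbb R^{p+q+1}$ (for instance, estimators computed from $X_0,\dots,X_n$), and let the residuals be $$\hat\varepsilon_t=\frac{X_t}{\hat\sigma_t},\qquad \hat\sigma_t^2=c_0(\hat{\boldsymbol\theta}_n)+\sum_{i=1}^tc_i(\hat{\boldsymbol\theta}_n)X_{t-i}^2,\qquad 1\le t\le n.$$ Let $h_n$ be real numbers and let $K$ be a probability density on $\mathbb R$ with mean $0$ and variance $1$, and define $$\hat f_n(x)=\frac1{nh_n}\sum_{t=1}^nK\Big(\frac{x-\hat\varepsilon_t}{h_n}\Big),\qquad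 f_n(x)=\frac1{nh_n}\sum_{t=1}^nK\Big(\frac{x-\varepsilon_t}{h_n}\Big),\qquad x\in\mathbb R.$$ Assume that, with $|\cdot|$ the maximum norm, $\sqrt n\,|\hat{\boldsymbol\theta}_n-\boldsymbol\theta|=O_P(1)$; that $\lim_{x\downarrow0}x^{-\zeta}P\{|\varepsilon_0|\le x\}=0$ for some $\zeta>0$; that $E|\varepsilon_0|<\infty$; and that 1. $h_n>0$, $h_n\to0$ and $\sqrt n\,h_n^2\to\infty$; 2. $\sup_{|x|>b}|x|K(x)\to0$ as $b\to\infty$; 3. there is a constant $C$ with $|K(x)-K(y)|\le C|x-y|$ for all $x,y\in\mathbb R$. Then $\sup_{x\in\mathbb R}|\hat f_n(x)-f_n(x)|=o_P(1)$ as $n\to\infty$. -/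

import Mathlib

open MeasureTheory ProbabilityTheory Filter Topology
open scoped ENNReal

noncomputable section

/-! ### Stochastic orders and strict stationarity -/

/-- `Z n = O_P(1)`. -/
def IsBigOPOne {Ω : Type*} [MeasurableSpace Ω] (P : Measure Ω) (Z : ℕ → Ω → ℝ) : Prop :=
  ∀ η : ℝ≥0∞, 0 < η → ∃ M : ℝ, ∀ᶠ n in atTop, P {ω | M < |Z n ω|} ≤ η

/-- `Z n = o_P(1)` for `[0, ∞]`-valued `Z n` (suprema are taken in `[0, ∞]`). -/
def IsLittleOPOne {Ω : Type*} [MeasurableSpace Ω] (P : Measure Ω) (Z : ℕ → Ω → ℝ≥0∞) : Prop :=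
  ∀ δ : ℝ≥0∞, 0 < δ → Tendsto (fun n => P {ω | δ < Z n ω}) atTop (𝓝 0)

/-- Strict stationarity of a two-sided process: all time shifts have the same law on the path
space `ℤ → E` (with the product σ-algebra). -/
def IsStrictlyStationary {Ω E : Type*} [MeasurableSpace Ω] [MeasurableSpace E]
    (P : Measure Ω) (Z : ℤ → Ω → E) : Prop :=
  ∀ k : ℤ, IdentDistrib (fun ω (t : ℤ) => Z (t + k) ω) (fun ω (t : ℤ) => Z t ω) P P

/-! ### Parameters of a GARCH(p, q) model -/

/-- Parameter vectors `u = (s, t)` in `ℝ^(p+q+1)`, `s = (s₀, …, s_p)`, `t = (t₁, …, t_q)`; here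
`u.1 i` is `s_i` and `u.2 j` is `t_{j+1}`. The norm of this product is the maximum norm.
For the true parameter, `s = (α₀, α₁, …, α_p)` and `t = (β₁, …, β_q)`. -/
abbrev GarchParam (p q : ℕ) : Type := (Fin (p + 1) → ℝ) × (Fin q → ℝ)

/-- The parameter space `Θ`, given the lower bound `lo`, the upper bound `hi` and `ρ₀`. -/
def garchParamSpace (p q : ℕ) (lo hi ρ₀ : ℝ) : Set (GarchParam p q) :=
  {u | ∑ j, u.2 j ≤ ρ₀ ∧ (∀ i, lo ≤ u.1 i ∧ u.1 i ≤ hi) ∧ ∀ j, lo ≤ u.2 j ∧ u.2 j ≤ hi}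

/-- The coefficients `c_i(u)`: `c₀ = s₀ / (1 - (t₁ + ⋯ + t_q))` and, for `i ≥ 1`,
`c_i = s_i + ∑_{1 ≤ j ≤ min q (i-1)} t_j c_{i-j}`, where `s_i = 0` for `i > p`. -/
def garchCoeff {p q : ℕ} (u : GarchParam p q) : ℕ → ℝ
  | 0 => u.1 0 / (1 - ∑ j, u.2 j)
  | i + 1 =>
      (if h : i + 1 < p + 1 then u.1 ⟨i + 1, h⟩ else 0) +
        ∑ j : Fin q, if (j : ℕ) < i then u.2 j * garchCoeff u (i - (j : ℕ)) else 0
  decreasing_by omega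

/-! ### The top Lyapunov exponent -/

/-- The matrix `A(e)` of the Markovian form `Y_t = A(ε_t) Y_{t-1} + b(ε_t)` of a GARCH(p, q) model,
where `Y_t = (X_t², …, X_{t-p+1}², σ_t², …, σ_{t-q+1}²)`. -/
def garchMatrix {p q : ℕ} (θ : GarchParam p q) (e : ℝ) : Matrix (Fin p ⊕ Fin q) (Fin p ⊕ Fin q) ℝ :=
  let coef : Fin p ⊕ Fin q → ℝ := Sum.elim (fun i => θ.1 i.succ) θ.2
  fun r c =>
    match r with
    | Sum.inl i =>
        if (i : ℕ) = 0 then e ^ 2 * coef c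
        else if ∃ i' : Fin p, c = Sum.inl i' ∧ (i' : ℕ) + 1 = i then 1 else 0
    | Sum.inr j =>
        if (j : ℕ) = 0 then coef c
        else if ∃ j' : Fin q, c = Sum.inr j' ∧ (j' : ℕ) + 1 = j then 1 else 0

/-- Expectation of an extended-real random variable, `E[g⁺] - E[g⁻]`. -/
def extExpectation {Ω : Type*} [MeasurableSpace Ω] (P : Measure Ω) (g : Ω → EReal) : EReal :=
  ((∫⁻ ω, (g ω).toENNReal ∂P : ℝ≥0∞) : EReal) - ((∫⁻ ω, (-g ω).toENNReal ∂P : ℝ≥0∞) : EReal)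

section Lyapunov

attribute [local instance] Matrix.linftyOpNormedAddCommGroup

/-- The top Lyapunov exponent `inf_{m ≥ 1} (1/m) E log ‖A(ε₀) A(ε₋₁) ⋯ A(ε_{-(m-1)})‖` of the model,
with `log 0 = -∞` and the operator norm of the maximum norm. -/
def garchLyapunov {Ω : Type*} [MeasurableSpace Ω] (P : Measure Ω) {p q : ℕ}
    (θ : GarchParam p q) (ε : ℤ → Ω → ℝ) : EReal :=
  ⨅ m : ℕ, extExpectation P (fun ω =>
    ENNReal.log (ENNReal.ofReal
      ‖((List.range (m + 1)).map (fun i : ℕ => garchMatrix θ (ε (-(i : ℤ)) ω))).prod‖)) /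
      ((m + 1 : ℕ) : EReal)

end Lyapunov

/-! ### Innovations and the GARCH process -/

/-- The innovations are i.i.d. with mean 0 and variance 1. -/
structure IsInnovation {Ω : Type*} [MeasurableSpace Ω] (P : Measure Ω) (ε : ℤ → Ω → ℝ) : Prop where
  measurable : ∀ t, Measurable (ε t)
  indep : iIndepFun ε P
  identDistrib : ∀ t, IdentDistrib (ε t) (ε 0) P P
  memLp : MemLp (ε 0) 2 P
  mean : ∫ ω, ε 0 ω ∂P = 0
  variance : ∫ ω, (ε 0 ω) ^ 2 ∂P = 1

/-- `(X, σ)` is a strictly stationary solution of the GARCH(p, q) equations with parameter `θ` and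
innovations `ε`, under the condition that the top Lyapunov exponent of the model is negative. -/
structure IsStationaryGarch {Ω : Type*} [MeasurableSpace Ω] (P : Measure Ω) {p q : ℕ}
    (θ : GarchParam p q) (ε X σ : ℤ → Ω → ℝ) : Prop where
  measurable_X : ∀ t, Measurable (X t)
  measurable_σ : ∀ t, Measurable (σ t)
  nonneg_σ : ∀ t, ∀ᵐ ω ∂P, 0 ≤ σ t ω
  observation : ∀ t, ∀ᵐ ω ∂P, X t ω = σ t ω * ε t ω
  volatility : ∀ t, ∀ᵐ ω ∂P,
    σ t ω ^ 2 = θ.1 0 + ∑ i : Fin p, θ.1 i.succ * X (t - ((i : ℤ) + 1)) ω ^ 2 +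
      ∑ j : Fin q, θ.2 j * σ (t - ((j : ℤ) + 1)) ω ^ 2
  lyapunov : garchLyapunov P θ ε < 0
  stationary : IsStrictlyStationary P (fun t ω => (X t ω, σ t ω))

/-! ### Residuals and kernel density estimators -/

/-- `c₀(u) + ∑_{i=1}^t c_i(u) x_{t-i}²`, the truncated conditional variance at time `t` computed
from the path `x` and the parameter `u`. -/
def garchTruncVar {p q : ℕ} (u : GarchParam p q) (x : ℤ → ℝ) (t : ℕ) : ℝ :=
  garchCoeff u 0 + ∑ i ∈ Finset.Icc 1 t, garchCoeff u i * x ((t : ℤ) - (i : ℤ)) ^ 2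

/-- The residual at time `t` computed from the path `x` and the parameter `u`. -/
def garchResidual {p q : ℕ} (u : GarchParam p q) (x : ℤ → ℝ) (t : ℕ) : ℝ :=
  x (t : ℤ) / Real.sqrt (garchTruncVar u x t)

/-- The kernel density estimator at `x` with kernel `K` and bandwidth `h` built from
`e 1, …, e n`. -/
def kernelDensity (K : ℝ → ℝ) (h : ℝ) (n : ℕ) (e : ℕ → ℝ) (x : ℝ) : ℝ :=
  1 / ((n : ℝ) * h) * ∑ t ∈ Finset.Icc 1 n, K ((x - e t) / h)

/-- `K` is a probability density function with mean 0 and variance 1. -/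
structure IsStdDensity (K : ℝ → ℝ) : Prop where
  nonneg : ∀ x, 0 ≤ K x
  integrable : Integrable K
  integral : ∫ x, K x = 1
  integrable_mean : Integrable (fun x => x * K x)
  mean : ∫ x, x * K x = 0
  integrable_variance : Integrable (fun x => x ^ 2 * K x)
  variance : ∫ x, x ^ 2 * K x = 1

end

noncomputable section

/-! ### Coefficients of the volatility expansion -/

section Coefficients

variable {p q : ℕ} {lo hi ρ₀ : ℝ} {u v : GarchParam p q}

/-! A Lipschitz kernel makes the two estimators differ, uniformly in `x`, by at most `C / (n h²)`
times the sum of `|ε̂_t - ε_t|` (`abs_kernelDensity_sub_le`). Since `√n h² → ∞`, it is enough that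
this sum be `O_P(√n)`.

Pathwise (`abs_garchResidual_sub_le`), `|ε̂_t - ε_t|` is at most `|ε_t|` times the relative error of
the fitted variance, which has two sources. Truncation at time 0 costs `O(r^t)`, because the true
and the truncated variance satisfy the same contracting recursion (`abs_sub_garchTruncVar_le`);
summed over `t` it stays finite. The parameter error costs `‖θ̂ - θ‖` times a random factor
(`abs_garchTruncVar_sub_div_le`): all parameters are bounded below, so each `c_i` has relative error
of order `i ‖θ̂ - θ‖`, up to a mild geometric growth. Each term `c_i X²` divided by the whole
variance lies in `[0, 1]`, so it may be replaced by its `s`-th power; the powers of `c_i` decay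
geometrically, and only a fractional moment of `X²` is needed. The factors then have bounded mean,
and Markov's inequality bounds their sum by `O_P(n)`, which multiplied by `‖θ̂ - θ‖ = O_P(n^{-1/2})`
gives `O_P(√n)`.

The fractional moment comes from the Lyapunov condition. Some block product of matrices has `E log
‖·‖ < 0`, hence `E ‖·‖^s < 1` for a small `s` (`exists_lintegral_rpow_lt_one`). Iterating over
independent blocks into the past gives a convergent geometric series for the state vector
(`lintegral_le_of_stochastic_recursion`). -/

theorem garchCoeff_zero (u : GarchParam p q) :
    garchCoeff u 0 = u.1 0 / (1 - ∑ j, u.2 j) := by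
  rw [garchCoeff]

theorem garchCoeff_succ (u : GarchParam p q) (i : ℕ) :
    garchCoeff u (i + 1) = (if h : i + 1 < p + 1 then u.1 ⟨i + 1, h⟩ else 0) +
      ∑ j : Fin q, if (j : ℕ) < i then u.2 j * garchCoeff u (i - (j : ℕ)) else 0 := by
  rw [garchCoeff]

theorem le_garchCoeff_zero (hlo : 0 < lo) (hρ₁ : ρ₀ < 1)
    (hu : u ∈ garchParamSpace p q lo hi ρ₀) : lo ≤ garchCoeff u 0 := by
  obtain ⟨h1, h2, h3⟩ := hu
  have h0 : 0 ≤ ∑ j, u.2 j := Finset.sum_nonneg fun j _ => hlo.le.trans (h3 j).1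
  rw [garchCoeff_zero, le_div_iff₀ (by linarith)]
  have := (h2 0).1
  nlinarith

theorem garchCoeff_nonneg (hlo : 0 < lo) (hρ₁ : ρ₀ < 1)
    (hu : u ∈ garchParamSpace p q lo hi ρ₀) (i : ℕ) : 0 ≤ garchCoeff u i := by
  induction i using Nat.strong_induction_on with
  | _ i ih =>
    rcases i with _ | i
    · exact hlo.le.trans (le_garchCoeff_zero hlo hρ₁ hu)
    · rw [garchCoeff_succ]
      refine add_nonneg ?_ (Finset.sum_nonneg fun j _ => ?_)
      · split_ifs with h
        · exact hlo.le.trans (hu.2.1 _).1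
        · exact le_rfl
      · split_ifs with h
        · exact mul_nonneg (hlo.le.trans (hu.2.2 _).1) (ih _ (by omega))
        · exact le_rfl

/-- A geometric convolution bound: the weights `u.2` act on geometric sequences of ratio `r`
as a contraction. -/
theorem sum_mul_geometric_le (hlo : 0 < lo) (hu : u ∈ garchParamSpace p q lo hi ρ₀) {r : ℝ}
    (hr : 0 < r) (hr1 : r ≤ 1) (hρr : ρ₀ ≤ r ^ (q + 1)) {i : ℕ} :
    ∑ j : Fin q, (if (j : ℕ) < i then u.2 j * r ^ (i - (j : ℕ)) else 0) ≤ r * r ^ (i + 1) := by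
  -- Here `j ≤ q - 1`, so `i - j + q ≥ i + 1`: the factor `r ^ q` brings all lags to a common power.
  -- Of `ρ₀ ≤ r ^ (q + 1)` one factor `r` is left over as the contraction.
  have key : ∀ j : Fin q, (if (j : ℕ) < i then u.2 j * r ^ (i - (j : ℕ)) else 0) * r ^ q ≤
      u.2 j * r ^ (i + 1) := by
    intro j
    have hj : 0 ≤ u.2 j := hlo.le.trans (hu.2.2 j).1
    split_ifs with h
    · rw [mul_assoc, ← pow_add]
      exact mul_le_mul_of_nonneg_left (pow_le_pow_of_le_one hr.le hr1 (by omega)) hj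
    · rw [zero_mul]; positivity
  have h2 := Finset.sum_le_sum fun j (_ : j ∈ Finset.univ) => key j
  rw [← Finset.sum_mul, ← Finset.sum_mul] at h2
  have h3 : (∑ j, u.2 j) * r ^ (i + 1) ≤ r ^ (q + 1) * r ^ (i + 1) :=
    mul_le_mul_of_nonneg_right (hu.1.trans hρr) (by positivity)
  have h4 : r ^ (q + 1) * r ^ (i + 1) = (r * r ^ (i + 1)) * r ^ q := by ring
  exact le_of_mul_le_mul_right (h2.trans (h3.trans h4.le)) (by positivity)

/-- Induction: the constant is chosen so that the input `s_i` uses at most a share `1 - r` of the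
bound and the convolution at most a share `r`. `garchCoeff u 0` never enters the recursion for the
later coefficients. -/
theorem garchCoeff_succ_le_geometric (hlo : 0 < lo) (hu : u ∈ garchParamSpace p q lo hi ρ₀)
    {r : ℝ} (hr : 0 < r) (hr1 : r < 1) (hρr : ρ₀ ≤ r ^ (q + 1)) (i : ℕ) :
    garchCoeff u (i + 1) ≤ hi / ((1 - r) * r ^ p) * r ^ (i + 1) := by
  have hhi : 0 < hi := hlo.trans_le ((hu.2.1 0).1.trans (hu.2.1 0).2)
  have hr' : 0 < 1 - r := by linarith
  set B := hi / ((1 - r) * r ^ p) with hB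
  have hB0 : 0 < B := by positivity
  induction i using Nat.strong_induction_on with
  | _ i ih =>
    rw [garchCoeff_succ]
    have h1 : (if h : i + 1 < p + 1 then u.1 ⟨i + 1, h⟩ else 0) ≤ (1 - r) * (B * r ^ (i + 1)) := by
      split_ifs with h
      · refine (hu.2.1 _).2.trans ?_
        have : hi = (1 - r) * (B * r ^ p) := by rw [hB]; field_simp
        rw [this]
        exact mul_le_mul_of_nonneg_left (mul_le_mul_of_nonneg_left
          (pow_le_pow_of_le_one hr.le hr1.le (by omega)) hB0.le) hr'.le
      · positivity
    have h2 : (∑ j : Fin q, if (j : ℕ) < i then u.2 j * garchCoeff u (i - (j : ℕ)) else 0) ≤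
        B * ∑ j : Fin q, (if (j : ℕ) < i then u.2 j * r ^ (i - (j : ℕ)) else 0) := by
      rw [Finset.mul_sum]
      refine Finset.sum_le_sum fun j _ => ?_
      split_ifs with h
      · have := ih (i - j - 1) (by omega)
        rw [show i - (j : ℕ) - 1 + 1 = i - j by omega] at this
        have hj : 0 ≤ u.2 j := hlo.le.trans (hu.2.2 j).1
        calc _ ≤ u.2 j * (B * r ^ (i - (j : ℕ))) := mul_le_mul_of_nonneg_left this hj
          _ = _ := by ring
      · simp
    have h3 := mul_le_mul_of_nonneg_left
      (sum_mul_geometric_le hlo hu hr hr1.le hρr (i := i)) hB0.le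
    calc _ ≤ (1 - r) * (B * r ^ (i + 1)) + B * (r * r ^ (i + 1)) :=
          add_le_add h1 (h2.trans h3)
      _ = _ := by ring

/-- `c_i` is a polynomial in the parameters with nonnegative coefficients and degree at most `i`, so
enlarging every parameter by a factor `a ≥ 1` costs at most `a ^ i`. -/
theorem garchCoeff_succ_le_pow_mul (hlo : 0 < lo) (hρ₁ : ρ₀ < 1)
    (hu : u ∈ garchParamSpace p q lo hi ρ₀) (hv : v ∈ garchParamSpace p q lo hi ρ₀) {a : ℝ}
    (ha : 1 ≤ a) (h1 : ∀ i, u.1 i ≤ a * v.1 i) (h2 : ∀ j, u.2 j ≤ a * v.2 j) (i : ℕ) :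
    garchCoeff u (i + 1) ≤ a ^ (i + 1) * garchCoeff v (i + 1) := by
  induction i using Nat.strong_induction_on with
  | _ i ih =>
    rw [garchCoeff_succ, garchCoeff_succ, mul_add, Finset.mul_sum]
    refine add_le_add ?_ (Finset.sum_le_sum fun j _ => ?_)
    · split_ifs with h
      · refine (h1 _).trans (mul_le_mul_of_nonneg_right ?_ (hlo.le.trans (hv.2.1 _).1))
        exact le_self_pow₀ ha (by omega)
      · simp
    · split_ifs with h
      · have := ih (i - j - 1) (by omega)
        rw [show i - (j : ℕ) - 1 + 1 = i - j by omega] at this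
        have hj : 0 ≤ v.2 j := hlo.le.trans (hv.2.2 j).1
        calc _ ≤ (a * v.2 j) * (a ^ (i - (j : ℕ)) * garchCoeff v (i - j)) :=
              mul_le_mul (h2 j) this (garchCoeff_nonneg hlo hρ₁ hu _) (by positivity)
          _ = a ^ (i - (j : ℕ) + 1) * (v.2 j * garchCoeff v (i - j)) := by ring
          _ ≤ _ := by
            refine mul_le_mul_of_nonneg_right (pow_le_pow_right₀ ha (by omega)) ?_
            exact mul_nonneg hj (garchCoeff_nonneg hlo hρ₁ hv _)
      · simp

theorem abs_fst_sub_le (u v : GarchParam p q) (i : Fin (p + 1)) : |u.1 i - v.1 i| ≤ ‖u - v‖ :=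
  calc |u.1 i - v.1 i| = ‖(u - v).1 i‖ := rfl
    _ ≤ ‖(u - v).1‖ := norm_le_pi_norm _ i
    _ ≤ ‖u - v‖ := norm_fst_le _

theorem abs_snd_sub_le (u v : GarchParam p q) (j : Fin q) : |u.2 j - v.2 j| ≤ ‖u - v‖ :=
  calc |u.2 j - v.2 j| = ‖(u - v).2 j‖ := rfl
    _ ≤ ‖(u - v).2‖ := norm_le_pi_norm _ j
    _ ≤ ‖u - v‖ := norm_snd_le _

/-- The lower bound `lo` turns an absolute error into a relative one. -/
theorem le_one_add_div_mul {lo a b d : ℝ} (hlo : 0 < lo) (hb : lo ≤ b) (hab : |a - b| ≤ d) :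
    a ≤ (1 + d / lo) * b := by
  have hd : 0 ≤ d := (abs_nonneg _).trans hab
  have h1 : d ≤ d / lo * b := by
    rw [div_mul_eq_mul_div, le_div_iff₀ hlo]
    exact mul_le_mul_of_nonneg_left hb hd
  have := (abs_le.1 hab).2
  linarith

theorem abs_garchCoeff_succ_sub_le (hlo : 0 < lo) (hρ₁ : ρ₀ < 1)
    (hu : u ∈ garchParamSpace p q lo hi ρ₀) (hv : v ∈ garchParamSpace p q lo hi ρ₀) (i : ℕ) :
    |garchCoeff u (i + 1) - garchCoeff v (i + 1)| ≤
      ((1 + ‖u - v‖ / lo) ^ (i + 1) - 1) * garchCoeff u (i + 1) := by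
  have ha : 1 ≤ 1 + ‖u - v‖ / lo := by
    have : 0 ≤ ‖u - v‖ / lo := by positivity
    linarith
  have huv := garchCoeff_succ_le_pow_mul hlo hρ₁ hu hv ha
    (fun i => le_one_add_div_mul hlo (hv.2.1 i).1 (abs_fst_sub_le u v i))
    (fun i => le_one_add_div_mul hlo (hv.2.2 i).1 (abs_snd_sub_le u v i)) i
  have hvu := garchCoeff_succ_le_pow_mul hlo hρ₁ hv hu ha
    (fun i => le_one_add_div_mul hlo (hu.2.1 i).1
      ((abs_fst_sub_le v u i).trans_eq (norm_sub_rev _ _)))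
    (fun i => le_one_add_div_mul hlo (hu.2.2 i).1
      ((abs_snd_sub_le v u i).trans_eq (norm_sub_rev _ _))) i
  have hA : 1 ≤ (1 + ‖u - v‖ / lo) ^ (i + 1) := one_le_pow₀ ha
  set A := (1 + ‖u - v‖ / lo) ^ (i + 1)
  have h0u := garchCoeff_nonneg hlo hρ₁ hu (i + 1)
  have h0v := garchCoeff_nonneg hlo hρ₁ hv (i + 1)
  rw [abs_le]
  constructor
  · nlinarith
  -- `huv` bounds the difference by `(A - 1) c(v)`; in the nontrivial case `c(v) < c(u)`, so `c(u)`
  -- may stand on the right.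
  · by_cases hc : garchCoeff u (i + 1) ≤ garchCoeff v (i + 1)
    · nlinarith
    · nlinarith

theorem abs_garchCoeff_zero_sub_le (hlo : 0 < lo) (hρ₁ : ρ₀ < 1)
    (hu : u ∈ garchParamSpace p q lo hi ρ₀) (hv : v ∈ garchParamSpace p q lo hi ρ₀) :
    |garchCoeff u 0 - garchCoeff v 0| ≤
      (1 / (1 - ρ₀) + hi * q / (1 - ρ₀) ^ 2) * ‖u - v‖ := by
  have hc : 0 < 1 - ρ₀ := by linarith
  have hU : 1 - ρ₀ ≤ 1 - ∑ j, u.2 j := by linarith [hu.1]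
  have hV : 1 - ρ₀ ≤ 1 - ∑ j, v.2 j := by linarith [hv.1]
  have hsum : |∑ j, u.2 j - ∑ j, v.2 j| ≤ q * ‖u - v‖ := by
    rw [← Finset.sum_sub_distrib]
    refine (Finset.abs_sum_le_sum_abs _ _).trans ?_
    refine (Finset.sum_le_sum fun j _ => abs_snd_sub_le u v j).trans ?_
    simp
  have hs := abs_fst_sub_le u v 0
  have hv0 : |v.1 0| ≤ hi := by
    rw [abs_of_nonneg (hlo.le.trans (hv.2.1 0).1)]; exact (hv.2.1 0).2
  have hhi : 0 ≤ hi := (abs_nonneg _).trans hv0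
  rw [garchCoeff_zero, garchCoeff_zero]
  set U := 1 - ∑ j, u.2 j
  set V := 1 - ∑ j, v.2 j
  have hU0 : 0 < U := hc.trans_le hU
  have hV0 : 0 < V := hc.trans_le hV
  have e : u.1 0 / U - v.1 0 / V = (u.1 0 - v.1 0) / U + v.1 0 * (V - U) / (U * V) := by
    field_simp; ring
  have hVU : |V - U| ≤ q * ‖u - v‖ := by
    simpa [U, V] using hsum
  rw [e]
  refine (abs_add_le _ _).trans ?_
  rw [abs_div, abs_div, abs_mul, abs_of_pos hU0, abs_of_pos (mul_pos hU0 hV0), add_mul]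
  refine add_le_add ?_ ?_
  · calc _ ≤ ‖u - v‖ / (1 - ρ₀) := by gcongr
      _ = _ := by ring
  · calc _ ≤ hi * (q * ‖u - v‖) / ((1 - ρ₀) * (1 - ρ₀)) := by gcongr
      _ = _ := by ring

end Coefficients

/-! ### The truncated conditional variance -/

section TruncVar

variable {p q : ℕ} {lo hi ρ₀ : ℝ} {u v : GarchParam p q}

theorem garchTruncVar_eq_sum_range (u : GarchParam p q) (x : ℤ → ℝ) (t : ℕ) :
    garchTruncVar u x t = garchCoeff u 0 +
      ∑ i ∈ Finset.range t, garchCoeff u (i + 1) * x ((t : ℤ) - 1 - i) ^ 2 := by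
  have h := Finset.sum_Ico_add' (fun i : ℕ => garchCoeff u i * x ((t : ℤ) - i) ^ 2) 0 t 1
  rw [zero_add] at h
  rw [garchTruncVar, Finset.range_eq_Ico]
  refine congrArg _ (h.symm.trans (Finset.sum_congr rfl fun i _ => ?_))
  congr 3
  push_cast
  ring

theorem le_garchTruncVar (hlo : 0 < lo) (hρ₁ : ρ₀ < 1)
    (hu : u ∈ garchParamSpace p q lo hi ρ₀) (x : ℤ → ℝ) (t : ℕ) : lo ≤ garchTruncVar u x t := by
  rw [garchTruncVar]
  have := le_garchCoeff_zero hlo hρ₁ hu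
  have h2 : 0 ≤ ∑ i ∈ Finset.Icc 1 t, garchCoeff u i * x ((t : ℤ) - (i : ℤ)) ^ 2 :=
    Finset.sum_nonneg fun i _ => mul_nonneg (garchCoeff_nonneg hlo hρ₁ hu i) (sq_nonneg _)
  linarith

theorem garchCoeff_mul_sq_le_garchTruncVar (hlo : 0 < lo) (hρ₁ : ρ₀ < 1)
    (hu : u ∈ garchParamSpace p q lo hi ρ₀) (x : ℤ → ℝ) {t i : ℕ} (hi : i ∈ Finset.range t) :
    garchCoeff u (i + 1) * x ((t : ℤ) - 1 - i) ^ 2 ≤ garchTruncVar u x t := by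
  rw [garchTruncVar_eq_sum_range]
  have h0 := garchCoeff_nonneg hlo hρ₁ hu 0
  have h2 := Finset.single_le_sum (f := fun i : ℕ => garchCoeff u (i + 1) * x ((t : ℤ) - 1 - i) ^ 2)
    (fun i _ => mul_nonneg (garchCoeff_nonneg hlo hρ₁ hu (i + 1)) (sq_nonneg _)) hi
  exact h2.trans (le_add_of_nonneg_left h0)

/-- The truncated variance satisfies the GARCH recursion as soon as all lags are available. -/
theorem garchTruncVar_recursion (hU : ∑ j, u.2 j < 1) (x : ℤ → ℝ) {t : ℕ} (ht : p + q + 1 ≤ t) :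
    garchTruncVar u x t = u.1 0 + ∑ i : Fin p, u.1 i.succ * x ((t : ℤ) - ((i : ℤ) + 1)) ^ 2 +
      ∑ j : Fin q, u.2 j * garchTruncVar u x (t - 1 - j) := by
  -- `c₀` is the fixed point of the recursion without observations.
  have hc : garchCoeff u 0 = u.1 0 + ∑ j : Fin q, u.2 j * garchCoeff u 0 := by
    have : 1 - ∑ j, u.2 j ≠ 0 := by linarith
    rw [← Finset.sum_mul, garchCoeff_zero]
    field_simp
    ring
  have h1 : ∑ i ∈ Finset.range t, (if h : i + 1 < p + 1 then u.1 ⟨i + 1, h⟩ else 0) *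
      x ((t : ℤ) - 1 - i) ^ 2 = ∑ i : Fin p, u.1 i.succ * x ((t : ℤ) - ((i : ℤ) + 1)) ^ 2 := by
    rw [← Finset.sum_subset (Finset.range_subset_range.2 (show p ≤ t by omega)),
      Finset.sum_range]
    · refine Finset.sum_congr rfl fun i _ => ?_
      rw [dif_pos (by omega)]
      congr 3
      ring
    · intro i _ hi
      rw [dif_neg (by simpa using hi), zero_mul]
  have h2 : ∀ j : Fin q, ∑ i ∈ Finset.range t,
      (if (j : ℕ) < i then u.2 j * garchCoeff u (i - (j : ℕ)) else 0) * x ((t : ℤ) - 1 - i) ^ 2 =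
      u.2 j * (garchTruncVar u x (t - 1 - j) - garchCoeff u 0) := by
    intro j
    rw [garchTruncVar_eq_sum_range, add_sub_cancel_left, Finset.mul_sum]
    have hj : t = (j + 1) + (t - 1 - j) := by omega
    conv_lhs => rw [hj]
    rw [Finset.sum_range_add, Finset.sum_eq_zero, zero_add]
    · refine Finset.sum_congr rfl fun i _ => ?_
      rw [if_pos (by omega), show (j : ℕ) + 1 + i - j = i + 1 by omega, mul_assoc]
      congr 4
      push_cast
      omega
    · intro i hi
      rw [if_neg (by simp at hi; omega), zero_mul]
  rw [garchTruncVar_eq_sum_range]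
  simp_rw [garchCoeff_succ, add_mul, Finset.sum_add_distrib, Finset.sum_mul]
  rw [h1, Finset.sum_comm]
  simp_rw [h2, mul_sub, Finset.sum_sub_distrib]
  linarith

/-- Starting values are forgotten at a geometric rate. -/
theorem abs_sub_garchTruncVar_le (hlo : 0 < lo) (hρ₁ : ρ₀ < 1)
    (hu : u ∈ garchParamSpace p q lo hi ρ₀) {r : ℝ}
    (hr : 0 < r) (hr1 : r ≤ 1) (hρr : ρ₀ ≤ r ^ (q + 1)) {x s : ℤ → ℝ}
    (hs : ∀ t, s t ^ 2 = u.1 0 + ∑ i : Fin p, u.1 i.succ * x (t - ((i : ℤ) + 1)) ^ 2 +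
      ∑ j : Fin q, u.2 j * s (t - ((j : ℤ) + 1)) ^ 2) (t : ℕ) :
    |s t ^ 2 - garchTruncVar u x t| ≤
      (∑ k ∈ Finset.range (p + q + 1), |s k ^ 2 - garchTruncVar u x k|) / r ^ (p + q + 1) *
        r ^ t := by
  set R := (∑ k ∈ Finset.range (p + q + 1), |s k ^ 2 - garchTruncVar u x k|) / r ^ (p + q + 1)
    with hR
  have hR0 : 0 ≤ R := by positivity
  induction t using Nat.strong_induction_on with
  | _ t ih =>
    by_cases ht : t < p + q + 1
    · have h1 : |s t ^ 2 - garchTruncVar u x t| ≤ R * r ^ (p + q + 1) := by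
        rw [hR, div_mul_cancel₀ _ (by positivity)]
        exact Finset.single_le_sum (f := fun k : ℕ => |s k ^ 2 - garchTruncVar u x k|)
          (fun _ _ => abs_nonneg _) (Finset.mem_range.2 ht)
      exact h1.trans (mul_le_mul_of_nonneg_left (pow_le_pow_of_le_one hr.le hr1 ht.le) hR0)
    · push Not at ht
      -- The intercept and the observed squares cancel, leaving a homogeneous recursion with weights
      -- `u.2`.
      have e : s t ^ 2 - garchTruncVar u x t =
          ∑ j : Fin q, u.2 j * (s ((t - 1 - j : ℕ) : ℤ) ^ 2 - garchTruncVar u x (t - 1 - j)) := by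
        rw [hs, garchTruncVar_recursion (hu.1.trans_lt hρ₁) x ht]
        simp_rw [mul_sub, Finset.sum_sub_distrib]
        have : ∀ j : Fin q, (t : ℤ) - ((j : ℤ) + 1) = ((t - 1 - j : ℕ) : ℤ) := fun j => by omega
        simp_rw [this]
        ring
      rw [e]
      refine (Finset.abs_sum_le_sum_abs _ _).trans ?_
      have h1 : ∀ j : Fin q, |u.2 j * (s ((t - 1 - j : ℕ) : ℤ) ^ 2 -
          garchTruncVar u x (t - 1 - j))| ≤
          R * (if (j : ℕ) < t - 1 then u.2 j * r ^ (t - 1 - (j : ℕ)) else 0) := by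
        intro j
        have hj : 0 ≤ u.2 j := hlo.le.trans (hu.2.2 j).1
        rw [if_pos (by omega), abs_mul, abs_of_nonneg hj]
        calc _ ≤ u.2 j * (R * r ^ (t - 1 - (j : ℕ))) :=
              mul_le_mul_of_nonneg_left (ih _ (by omega)) hj
          _ = _ := by ring
      refine (Finset.sum_le_sum fun j _ => h1 j).trans ?_
      rw [← Finset.mul_sum]
      refine mul_le_mul_of_nonneg_left ?_ hR0
      refine (sum_mul_geometric_le hlo hu hr hr1 hρr).trans ?_
      rw [show t - 1 + 1 = t by omega]
      exact mul_le_of_le_one_left (by positivity) hr1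

theorem one_add_pow_sub_one_le {d : ℝ} (hd : 0 ≤ d) (n : ℕ) :
    (1 + d) ^ n - 1 ≤ n * d * (1 + d) ^ n := by
  induction n with
  | zero => simp
  | succ n ih =>
    have h1 : (1 : ℝ) ≤ (1 + d) ^ n := one_le_pow₀ (by linarith)
    rw [pow_succ]
    push_cast
    nlinarith [mul_nonneg hd hd, mul_nonneg hd (sub_nonneg.2 h1),
      mul_le_mul_of_nonneg_right ih (show 0 ≤ 1 + d by linarith),
      mul_nonneg (mul_nonneg hd hd) (sub_nonneg.2 h1)]

/-- The relative error of the truncated variance is linear in the parameter error. -/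
theorem abs_garchTruncVar_sub_div_le (hlo : 0 < lo) (hρ₁ : ρ₀ < 1)
    (hu : u ∈ garchParamSpace p q lo hi ρ₀) (hv : v ∈ garchParamSpace p q lo hi ρ₀) {r s τ : ℝ}
    (hr : 0 < r) (hr1 : r < 1) (hρr : ρ₀ ≤ r ^ (q + 1)) (hs : 0 < s) (hs1 : s ≤ 1)
    (hτ : (1 + ‖u - v‖ / lo) * r ^ s ≤ τ) (x : ℤ → ℝ) (t : ℕ) :
    |garchTruncVar u x t - garchTruncVar v x t| / garchTruncVar u x t ≤
      ‖u - v‖ * ((1 / (1 - ρ₀) + hi * q / (1 - ρ₀) ^ 2) / lo +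
        (hi / ((1 - r) * r ^ p) / lo) ^ s / lo * ∑ i ∈ Finset.range t,
          ((i + 1 : ℕ) : ℝ) * τ ^ (i + 1) * (x ((t : ℤ) - 1 - i) ^ 2) ^ s) := by
  have hhi : 0 < hi := hlo.trans_le ((hu.2.1 0).1.trans (hu.2.1 0).2)
  have hT := le_garchTruncVar hlo hρ₁ hu x t
  have hT0 : 0 < garchTruncVar u x t := hlo.trans_le hT
  set B := hi / ((1 - r) * r ^ p) with hB
  have hr' : 0 < 1 - r := by linarith
  have hB0 : 0 < B := by positivity
  set T := garchTruncVar u x t with hTdef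
  set d := ‖u - v‖ with hd
  have hd0 : 0 ≤ d := norm_nonneg _
  have hdl : 0 ≤ d / lo := by positivity
  have h0 := abs_garchCoeff_zero_sub_le hlo hρ₁ hu hv
  have e : garchTruncVar u x t - garchTruncVar v x t = (garchCoeff u 0 - garchCoeff v 0) +
      ∑ i ∈ Finset.range t, (garchCoeff u (i + 1) - garchCoeff v (i + 1)) *
        x ((t : ℤ) - 1 - i) ^ 2 := by
    rw [garchTruncVar_eq_sum_range, garchTruncVar_eq_sum_range]
    simp_rw [sub_mul, Finset.sum_sub_distrib]
    ring
  have hterm : ∀ i ∈ Finset.range t, |(garchCoeff u (i + 1) - garchCoeff v (i + 1)) *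
      x ((t : ℤ) - 1 - i) ^ 2| / T ≤ d * ((B / lo) ^ s / lo *
        (((i + 1 : ℕ) : ℝ) * τ ^ (i + 1) * (x ((t : ℤ) - 1 - i) ^ 2) ^ s)) := by
    intro i hi
    set w := x ((t : ℤ) - 1 - i) ^ 2 with hw
    have hw0 : 0 ≤ w := sq_nonneg _
    have hc0 := garchCoeff_nonneg hlo hρ₁ hu (i + 1)
    have h1 := abs_garchCoeff_succ_sub_le hlo hρ₁ hu hv i
    have h2 := one_add_pow_sub_one_le hdl (i + 1)
    -- The ratio lies in `[0, 1]`, so it is at most its `s`-th power; only then are `T ≥ lo` and the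
    -- geometric bound used. This leaves `w ^ s` in place of `w`, with decay `r ^ s` to absorb the
    -- growth `1 + d / lo`.
    have hcw : garchCoeff u (i + 1) * w / T ≤ (B / lo) ^ s * (r ^ s) ^ (i + 1) * w ^ s := by
      have ha1 : garchCoeff u (i + 1) * w / T ≤ 1 :=
        (div_le_one hT0).2 (garchCoeff_mul_sq_le_garchTruncVar hlo hρ₁ hu x hi)
      have ha0 : 0 ≤ garchCoeff u (i + 1) * w / T := by positivity
      calc garchCoeff u (i + 1) * w / T ≤ (garchCoeff u (i + 1) * w / T) ^ s := by
            simpa using Real.rpow_le_rpow_of_exponent_ge_of_imp ha0 ha1 hs1 (fun _ h => absurd h one_ne_zero)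
        _ ≤ (B * r ^ (i + 1) * w / lo) ^ s := by
            refine Real.rpow_le_rpow ha0 ?_ hs.le
            gcongr
            exact garchCoeff_succ_le_geometric hlo hu hr hr1 hρr i
        _ = (B / lo * r ^ (i + 1) * w) ^ s := by congr 1; ring
        _ = _ := by
            rw [Real.mul_rpow (by positivity) hw0, Real.mul_rpow (by positivity) (by positivity),
              ← Real.rpow_natCast, ← Real.rpow_natCast, ← Real.rpow_mul hr.le,
              ← Real.rpow_mul hr.le, mul_comm s]
    rw [abs_mul, abs_of_nonneg hw0]
    calc |garchCoeff u (i + 1) - garchCoeff v (i + 1)| * w / T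
        ≤ (((i + 1 : ℕ) : ℝ) * (d / lo) * (1 + d / lo) ^ (i + 1) * garchCoeff u (i + 1)) * w / T := by
          gcongr
          exact h1.trans (mul_le_mul_of_nonneg_right h2 hc0)
      _ = ((i + 1 : ℕ) : ℝ) * (d / lo) * (1 + d / lo) ^ (i + 1) *
            (garchCoeff u (i + 1) * w / T) := by ring
      _ ≤ ((i + 1 : ℕ) : ℝ) * (d / lo) * (1 + d / lo) ^ (i + 1) *
            ((B / lo) ^ s * (r ^ s) ^ (i + 1) * w ^ s) := by gcongr
      _ = d * ((B / lo) ^ s / lo * (((i + 1 : ℕ) : ℝ) *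
            ((1 + d / lo) * r ^ s) ^ (i + 1) * w ^ s)) := by rw [mul_pow]; ring
      _ ≤ _ := by gcongr
  have h00 : |garchCoeff u 0 - garchCoeff v 0| / T ≤
      d * ((1 / (1 - ρ₀) + hi * q / (1 - ρ₀) ^ 2) / lo) := by
    have hc : 0 < 1 - ρ₀ := by linarith
    calc _ ≤ ((1 / (1 - ρ₀) + hi * q / (1 - ρ₀) ^ 2) * d) / lo := by gcongr
      _ = _ := by ring
  rw [e, mul_add, Finset.mul_sum, Finset.mul_sum]
  refine le_trans (div_le_div_of_nonneg_right ((abs_add_le _ _).trans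
    (add_le_add_right (Finset.abs_sum_le_sum_abs _ _) _)) hT0.le) ?_
  rw [add_div, Finset.sum_div]
  exact add_le_add h00 (Finset.sum_le_sum hterm)

/-- Rationalise `s - √T = (s² - T) / (s + √T)` and use `s + √T ≥ √T`. -/
theorem abs_div_sqrt_sub_le {s e T : ℝ} (hs : 0 ≤ s) (hT : 0 < T) :
    |s * e / √T - e| ≤ |e| * (|s ^ 2 - T| / T) := by
  have hq : 0 < √T := Real.sqrt_pos.2 hT
  have hsq : √T ^ 2 = T := Real.sq_sqrt hT.le
  have e1 : s * e / √T - e = e * ((s - √T) / √T) := by field_simp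
  rw [e1, abs_mul, abs_div, abs_of_pos hq]
  refine mul_le_mul_of_nonneg_left ?_ (abs_nonneg _)
  rw [div_le_div_iff₀ hq hT]
  have e2 : s ^ 2 - T = (s - √T) * (s + √T) := by nth_rewrite 1 [← hsq]; ring
  rw [e2, abs_mul, abs_of_nonneg (by positivity : 0 ≤ s + √T)]
  have : |s - √T| * T = |s - √T| * √T * √T := by rw [mul_assoc, Real.mul_self_sqrt hT.le]
  rw [this]
  have := abs_nonneg (s - √T)
  gcongr
  linarith

/-- Pathwise bound for the error of the residuals. -/
theorem abs_garchResidual_sub_le (hlo : 0 < lo) (hρ₁ : ρ₀ < 1)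
    (hu : u ∈ garchParamSpace p q lo hi ρ₀) (hv : v ∈ garchParamSpace p q lo hi ρ₀) {r s τ : ℝ}
    (hr : 0 < r) (hr1 : r < 1) (hρr : ρ₀ ≤ r ^ (q + 1)) (hs : 0 < s) (hs1 : s ≤ 1)
    (hτ : (1 + ‖u - v‖ / lo) * r ^ s ≤ τ) {x y e : ℤ → ℝ} (hy0 : ∀ t, 0 ≤ y t)
    (hx : ∀ t, x t = y t * e t)
    (hy : ∀ t, y t ^ 2 = v.1 0 + ∑ i : Fin p, v.1 i.succ * x (t - ((i : ℤ) + 1)) ^ 2 +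
      ∑ j : Fin q, v.2 j * y (t - ((j : ℤ) + 1)) ^ 2) (t : ℕ) :
    |garchResidual u x t - e t| ≤
      (∑ k ∈ Finset.range (p + q + 1), |y k ^ 2 - garchTruncVar v x k|) / r ^ (p + q + 1) / lo *
        (r ^ t * |e t|) +
      ‖u - v‖ * (|e t| * ((1 / (1 - ρ₀) + hi * q / (1 - ρ₀) ^ 2) / lo +
        (hi / ((1 - r) * r ^ p) / lo) ^ s / lo * ∑ i ∈ Finset.range t,
          ((i + 1 : ℕ) : ℝ) * τ ^ (i + 1) * (x ((t : ℤ) - 1 - i) ^ 2) ^ s)) := by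
  have hT := le_garchTruncVar hlo hρ₁ hu x t
  have hT0 : 0 < garchTruncVar u x t := hlo.trans_le hT
  have h1 := abs_sub_garchTruncVar_le hlo hρ₁ hv hr hr1.le hρr hy t
  have h2 := abs_garchTruncVar_sub_div_le hlo hρ₁ hu hv hr hr1 hρr hs hs1 hτ x t
  set T := garchTruncVar u x t
  set R := (∑ k ∈ Finset.range (p + q + 1), |y k ^ 2 - garchTruncVar v x k|) / r ^ (p + q + 1)
  have hR0 : 0 ≤ R := by positivity
  rw [garchResidual, hx]
  refine (abs_div_sqrt_sub_le (hy0 t) hT0).trans ?_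
  have h3 : |y t ^ 2 - T| / T ≤ R * r ^ t / lo + |T - garchTruncVar v x t| / T := by
    calc |y t ^ 2 - T| / T
        ≤ (|y t ^ 2 - garchTruncVar v x t| + |T - garchTruncVar v x t|) / T := by
          gcongr
          rw [abs_sub_comm T]
          exact abs_sub_le _ _ _
      _ ≤ R * r ^ t / T + |T - garchTruncVar v x t| / T := by
          rw [add_div]; gcongr
      _ ≤ _ := by gcongr
  refine (mul_le_mul_of_nonneg_left (h3.trans (add_le_add_right h2 _)) (abs_nonneg _)).trans_eq ?_
  ring

end TruncVar

/-! ### Stochastic recursions with contracting multipliers -/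

section StochasticRecursion

variable {Ω : Type*} [MeasurableSpace Ω] {P : Measure Ω}

theorem le_prod_mul_add_sum_prod_mul {z a d : ℕ → ℝ≥0∞} (h : ∀ k, z k ≤ a k * z (k + 1) + d k)
    (n : ℕ) : z 0 ≤ (∏ i ∈ Finset.range n, a i) * z n +
      ∑ l ∈ Finset.range n, (∏ i ∈ Finset.range l, a i) * d l := by
  induction n with
  | zero => simp
  | succ n ih =>
    rw [Finset.prod_range_succ, Finset.sum_range_succ]
    calc z 0 ≤ _ := ih
      _ ≤ (∏ i ∈ Finset.range n, a i) * (a n * z (n + 1) + d n) +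
          ∑ l ∈ Finset.range n, (∏ i ∈ Finset.range l, a i) * d l := by gcongr; exact h n
      _ = _ := by ring

theorem tendsto_measure_natCast_lt [IsFiniteMeasure P] {z : Ω → ℝ≥0∞} (hm : Measurable z)
    (hfin : ∀ᵐ ω ∂P, z ω ≠ ⊤) :
    Tendsto (fun L : ℕ => P {ω | (L : ℝ≥0∞) < z ω}) atTop (𝓝 0) := by
  have := tendsto_measure_iInter_atTop (μ := P) (s := fun L : ℕ => {ω | (L : ℝ≥0∞) < z ω})
    (fun L => (measurableSet_lt measurable_const hm).nullMeasurableSet)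
    (fun a b hab ω (hω : (b : ℝ≥0∞) < z ω) =>
      show (a : ℝ≥0∞) < z ω from lt_of_le_of_lt (by exact_mod_cast hab) hω)
    ⟨0, measure_ne_top _ _⟩
  have h0 : P (⋂ L : ℕ, {ω | (L : ℝ≥0∞) < z ω}) = 0 := by
    refine measure_mono_null (fun ω hω => ?_) (ae_iff.1 hfin)
    simp only [Set.mem_iInter, Set.mem_ofPred_eq] at hω
    simp only [not_not, Set.mem_ofPred_eq]
    by_contra hne
    obtain ⟨L, hL⟩ := ENNReal.exists_nat_gt hne
    exact lt_asymm hL (hω L)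
  rwa [h0] at this

/-- A sequence of identically distributed finite random variables does not tend to infinity. -/
theorem ae_exists_frequently_le_of_identDistrib {z : ℕ → Ω → ℝ≥0∞} [IsFiniteMeasure P]
    (hm : ∀ k, Measurable (z k)) (hz : ∀ k, IdentDistrib (z k) (z 0) P P)
    (hfin : ∀ᵐ ω ∂P, z 0 ω ≠ ⊤) :
    ∀ᵐ ω ∂P, ∃ L : ℕ, ∃ᶠ k in atTop, z k ω ≤ L := by
  -- The event is an increasing union over `n` of events contained in `{L < z n}`, all of the same
  -- probability as `{L < z 0}`.
  have key : ∀ L : ℕ, P {ω | ∀ᶠ k in atTop, (L : ℝ≥0∞) < z k ω} ≤ P {ω | (L : ℝ≥0∞) < z 0 ω} := by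
    intro L
    have e : {ω | ∀ᶠ k in atTop, (L : ℝ≥0∞) < z k ω} =
        ⋃ n : ℕ, ⋂ k ∈ Set.Ici n, {ω | (L : ℝ≥0∞) < z k ω} := by
      ext ω; simp [eventually_atTop]
    rw [e, Monotone.measure_iUnion]
    · refine iSup_le fun n => (measure_mono (Set.biInter_subset_of_mem (Set.self_mem_Ici))).trans ?_
      exact ((hz n).measure_mem_eq measurableSet_Ioi).le
    · intro m n hmn
      exact Set.biInter_subset_biInter_left (Set.Ici_subset_Ici.2 hmn)
  have hlim := tendsto_measure_natCast_lt (hm 0) hfin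
  rw [ae_iff]
  refine le_antisymm (ge_of_tendsto' hlim fun L => (measure_mono fun ω hω => ?_).trans (key L))
    (zero_le)
  simp only [not_exists, Set.mem_ofPred_eq] at hω ⊢
  simpa using hω L

/-- Moment bound for the stationary solution of a recursion whose random multipliers are
contracting in mean. -/
theorem lintegral_le_of_stochastic_recursion [IsProbabilityMeasure P] {z a d : ℕ → Ω → ℝ≥0∞}
    (hzm : ∀ k, Measurable (z k)) (ham : ∀ k, Measurable (a k)) (hdm : ∀ k, Measurable (d k))
    (hz : ∀ k, IdentDistrib (z k) (z 0) P P) (hfin : ∀ᵐ ω ∂P, z 0 ω ≠ ⊤)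
    (hrec : ∀ k, ∀ᵐ ω ∂P, z k ω ≤ a k ω * z (k + 1) ω + d k ω) {κ D : ℝ≥0∞} (hκ : κ < 1)
    (ha : ∀ l, ∫⁻ ω, ∏ i ∈ Finset.range l, a i ω ∂P ≤ κ ^ l)
    (hd : ∀ l, ∫⁻ ω, (∏ i ∈ Finset.range l, a i ω) * d l ω ∂P ≤ κ ^ l * D) :
    ∫⁻ ω, z 0 ω ∂P ≤ (1 - κ)⁻¹ * D := by
  have hpm : ∀ l, Measurable fun ω => ∏ i ∈ Finset.range l, a i ω := fun l =>
    Finset.measurable_fun_prod _ fun i _ => ham i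
  have hprod : ∀ᵐ ω ∂P, Tendsto (fun l => ∏ i ∈ Finset.range l, a i ω) atTop (𝓝 0) := by
    have h1 : ∫⁻ ω, ∑' l, ∏ i ∈ Finset.range l, a i ω ∂P ≠ ⊤ := by
      rw [lintegral_tsum fun l => (hpm l).aemeasurable]
      refine ((ENNReal.tsum_le_tsum ha).trans_lt ?_).ne
      rw [ENNReal.tsum_geometric]
      exact ENNReal.inv_lt_top.2 (tsub_pos_of_lt hκ)
    filter_upwards [ae_lt_top (Measurable.tsum hpm) h1] with ω hω
    exact ENNReal.tendsto_atTop_zero_of_tsum_ne_top hω.ne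
  -- Since `z` is not known to be integrable, the recursion is iterated pathwise: along the times
  -- where `z n ≤ L`, the remainder is at most `L` times a product tending to 0.
  have hle : ∀ᵐ ω ∂P, z 0 ω ≤ ∑' l, (∏ i ∈ Finset.range l, a i ω) * d l ω := by
    filter_upwards [hprod, ae_exists_frequently_le_of_identDistrib hzm hz hfin,
      ae_all_iff.2 hrec] with ω h1 ⟨L, hL⟩ h3
    have h4 : Tendsto (fun n => (∏ i ∈ Finset.range n, a i ω) * L +
        ∑' l, (∏ i ∈ Finset.range l, a i ω) * d l ω) atTop
        (𝓝 (0 * L + ∑' l, (∏ i ∈ Finset.range l, a i ω) * d l ω)) :=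
      (ENNReal.Tendsto.mul_const h1 (Or.inr (ENNReal.natCast_ne_top L))).add_const _
    rw [zero_mul, zero_add] at h4
    refine ge_of_tendsto_of_frequently h4 (hL.mono fun n hn => ?_)
    refine (le_prod_mul_add_sum_prod_mul h3 n).trans (add_le_add ?_ (ENNReal.sum_le_tsum _))
    gcongr
  calc ∫⁻ ω, z 0 ω ∂P ≤ ∫⁻ ω, ∑' l, (∏ i ∈ Finset.range l, a i ω) * d l ω ∂P :=
        lintegral_mono_ae hle
    _ = ∑' l, ∫⁻ ω, (∏ i ∈ Finset.range l, a i ω) * d l ω ∂P :=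
        lintegral_tsum fun l => ((hpm l).mul (hdm l)).aemeasurable
    _ ≤ ∑' l, κ ^ l * D := ENNReal.tsum_le_tsum hd
    _ = _ := by rw [ENNReal.tsum_mul_right, ENNReal.tsum_geometric]

end StochasticRecursion

/-! ### From a negative logarithmic moment to a fractional moment -/

section FractionalMoment

/-- Difference quotient of `s ↦ y ^ s` at 0 with increment `1 / (k + 1)`. -/
theorem tendsto_mul_rpow_inv_sub_one {y : ℝ} (hy : 0 < y) :
    Tendsto (fun k : ℕ => ((k : ℝ) + 1) * (y ^ ((k : ℝ) + 1)⁻¹ - 1)) atTop (𝓝 (Real.log y)) := by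
  have hd : HasDerivAt (fun s : ℝ => y ^ s) (Real.log y) 0 := by
    simpa using Real.hasStrictDerivAt_const_rpow hy 0 |>.hasDerivAt
  have h1 := hd.tendsto_slope_zero_right
  have h2 : Tendsto (fun k : ℕ => ((k : ℝ) + 1)⁻¹) atTop (𝓝[>] 0) := by
    refine tendsto_nhdsWithin_iff.2 ⟨?_, Eventually.of_forall fun k => ?_⟩
    · exact tendsto_inv_atTop_zero.comp
        (tendsto_atTop_add_const_right _ _ tendsto_natCast_atTop_atTop)
    · exact Set.mem_Ioi.2 (by positivity)
  refine (h1.comp h2).congr fun k => ?_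
  simp

/-- Bernoulli's inequality for exponents in `[0, 1]`; it provides the dominating function for the
limit above. -/
theorem mul_rpow_inv_sub_one_le {y : ℝ} (hy : 0 ≤ y) (k : ℕ) :
    ((k : ℝ) + 1) * (y ^ ((k : ℝ) + 1)⁻¹ - 1) ≤ y := by
  have hk : (0 : ℝ) < (k : ℝ) + 1 := by positivity
  have h := rpow_one_add_le_one_add_mul_self (s := y - 1) (p := ((k : ℝ) + 1)⁻¹) (by linarith)
    (by positivity) (inv_le_one_of_one_le₀ (by linarith [k.cast_nonneg (α := ℝ)]))
  rw [add_sub_cancel] at h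
  calc ((k : ℝ) + 1) * (y ^ ((k : ℝ) + 1)⁻¹ - 1)
      ≤ ((k : ℝ) + 1) * (((k : ℝ) + 1)⁻¹ * (y - 1)) := by
        refine mul_le_mul_of_nonneg_left ?_ hk.le
        linarith
    _ = y - 1 := by field_simp
    _ ≤ y := by linarith

theorem toENNReal_log_ofReal_le (y : ℝ) :
    (ENNReal.log (ENNReal.ofReal y)).toENNReal ≤ ENNReal.ofReal y := by
  rcases le_or_gt y 0 with hy | hy
  · simp [ENNReal.ofReal_of_nonpos hy]
  · rw [ENNReal.log_ofReal_of_pos hy, EReal.real_coe_toENNReal]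
    exact ENNReal.ofReal_le_ofReal (Real.log_le_self hy.le)

variable {Ω : Type*} [MeasurableSpace Ω] {P : Measure Ω}

/-- If `E log N < 0` and `E N < ∞`, then `E N ^ s < 1` for some `s ∈ (0, 1]`. -/
theorem exists_lintegral_rpow_lt_one [IsProbabilityMeasure P] {N : Ω → ℝ} (hN : Measurable N)
    (hN0 : ∀ ω, 0 ≤ N ω) (hfin : ∫⁻ ω, ENNReal.ofReal (N ω) ∂P ≠ ⊤)
    (hlog : extExpectation P (fun ω => ENNReal.log (ENNReal.ofReal (N ω))) < 0) :
    ∃ s : ℝ, 0 < s ∧ s ≤ 1 ∧ ∫⁻ ω, ENNReal.ofReal (N ω ^ s) ∂P < 1 := by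
  set a := ∫⁻ ω, (ENNReal.log (ENNReal.ofReal (N ω))).toENNReal ∂P with ha
  set b := ∫⁻ ω, (-ENNReal.log (ENNReal.ofReal (N ω))).toENNReal ∂P with hb
  have ha_top : a ≠ ⊤ :=
    ((lintegral_mono fun ω => toENNReal_log_ofReal_le (N ω)).trans_lt hfin.lt_top).ne
  have hab : a < b := by
    have : (a : EReal) - (b : EReal) < 0 := hlog
    rw [EReal.sub_neg (Or.inl (by simpa using ha_top)) (Or.inl (by simp))] at this
    exact_mod_cast this
  -- `f k` and `g k` are the positive and negative parts of `(N ^ s - 1) / s` at `s = 1 / (k + 1)`,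
  -- with limits `log⁺ N` and `log⁻ N`. Dominated convergence handles `f`; `E log⁻ N` may be
  -- infinite, so `g` goes through Fatou.
  set f : ℕ → Ω → ℝ≥0∞ := fun k ω =>
    ENNReal.ofReal (((k : ℝ) + 1) * (N ω ^ ((k : ℝ) + 1)⁻¹ - 1)) with hf
  set g : ℕ → Ω → ℝ≥0∞ := fun k ω =>
    ENNReal.ofReal (((k : ℝ) + 1) * (1 - N ω ^ ((k : ℝ) + 1)⁻¹)) with hg
  have hfm : ∀ k, Measurable (f k) := fun k => by fun_prop
  have hgm : ∀ k, Measurable (g k) := fun k => by fun_prop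
  have hflim : ∀ ω, Tendsto (fun k => f k ω) atTop
      (𝓝 (ENNReal.log (ENNReal.ofReal (N ω))).toENNReal) := by
    intro ω
    rcases (hN0 ω).eq_or_lt with h | h
    · have : ∀ k, f k ω = 0 := fun k => by
        simp only [hf, ← h]
        rw [Real.zero_rpow (by positivity)]
        exact ENNReal.ofReal_of_nonpos (by nlinarith [k.cast_nonneg (α := ℝ)])
      simp [this, ← h]
    · rw [ENNReal.log_ofReal_of_pos h, EReal.real_coe_toENNReal]
      exact ENNReal.tendsto_ofReal (tendsto_mul_rpow_inv_sub_one h)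
  have hglim : ∀ ω, Tendsto (fun k => g k ω) atTop
      (𝓝 (-ENNReal.log (ENNReal.ofReal (N ω))).toENNReal) := by
    intro ω
    rcases (hN0 ω).eq_or_lt with h | h
    · have : ∀ k : ℕ, g k ω = ((k + 1 : ℕ) : ℝ≥0∞) := fun k => by
        simp only [hg, ← h]
        rw [Real.zero_rpow (by positivity), sub_zero, mul_one]
        exact_mod_cast ENNReal.ofReal_natCast (k + 1)
      simp only [this, ← h, ENNReal.ofReal_zero, ENNReal.log_zero, EReal.neg_bot,
        EReal.toENNReal_top]
      exact ENNReal.tendsto_nat_nhds_top.comp (tendsto_add_atTop_nat 1)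
    · rw [ENNReal.log_ofReal_of_pos h, ← EReal.coe_neg, EReal.real_coe_toENNReal]
      refine ENNReal.tendsto_ofReal ((tendsto_mul_rpow_inv_sub_one h).neg.congr fun k => ?_)
      ring
  have hfint : Tendsto (fun k => ∫⁻ ω, f k ω ∂P) atTop (𝓝 a) :=
    tendsto_lintegral_of_dominated_convergence (fun ω => ENNReal.ofReal (N ω)) hfm
      (fun k => Eventually.of_forall fun ω =>
        ENNReal.ofReal_le_ofReal (mul_rpow_inv_sub_one_le (hN0 ω) k))
      hfin (Eventually.of_forall hflim)
  have hgint : b ≤ liminf (fun k => ∫⁻ ω, g k ω ∂P) atTop := by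
    calc b = ∫⁻ ω, liminf (fun k => g k ω) atTop ∂P :=
          lintegral_congr fun ω => (hglim ω).liminf_eq.symm
      _ ≤ _ := lintegral_liminf_le (u := atTop) hgm
  obtain ⟨c, hac, hcb⟩ := exists_between hab
  have hg_ev : ∀ᶠ k in atTop, c < ∫⁻ ω, g k ω ∂P :=
    eventually_lt_of_lt_liminf (hcb.trans_le hgint)
  obtain ⟨k, hk1, hk2⟩ := ((hfint.eventually_lt_const hac).and hg_ev).exists
  have hk0 : (0 : ℝ) < (k : ℝ) + 1 := by positivity
  refine ⟨((k : ℝ) + 1)⁻¹, by positivity,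
    inv_le_one_of_one_le₀ (by linarith [k.cast_nonneg (α := ℝ)]), ?_⟩
  set s := ((k : ℝ) + 1)⁻¹ with hs
  set w := ENNReal.ofReal ((k : ℝ) + 1) with hw
  have hw0 : w ≠ 0 := by simpa [hw] using hk0
  -- The identity `N ^ s = 1 + s (f - g)`, cleared of subtraction so that it integrates in `[0, ∞]`.
  have hpt : ∀ ω, w * ENNReal.ofReal (N ω ^ s) + g k ω = w + f k ω := by
    intro ω
    have hNs : 0 ≤ N ω ^ s := Real.rpow_nonneg (hN0 ω) s
    simp only [hg, hf]
    rw [hw, ← ENNReal.ofReal_mul hk0.le]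
    rcases le_total (N ω ^ s) 1 with h | h
    · rw [ENNReal.ofReal_of_nonpos (p := _ * (N ω ^ s - 1)) (by nlinarith), add_zero,
        ← ENNReal.ofReal_add (by positivity) (by nlinarith)]
      congr 1; ring
    · rw [ENNReal.ofReal_of_nonpos (p := _ * (1 - N ω ^ s)) (by nlinarith), add_zero,
        ← ENNReal.ofReal_add (by positivity) (by nlinarith)]
      congr 1; ring
  have hint : w * ∫⁻ ω, ENNReal.ofReal (N ω ^ s) ∂P + ∫⁻ ω, g k ω ∂P =
      w + ∫⁻ ω, f k ω ∂P := by
    rw [← lintegral_const_mul _ (by fun_prop), ← lintegral_add_right _ (hgm k)]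
    simp_rw [hpt]
    rw [lintegral_add_right _ (hfm k)]
    simp
  by_contra hcon
  push Not at hcon
  have h1 : w + ∫⁻ ω, f k ω ∂P < w + ∫⁻ ω, g k ω ∂P :=
    ENNReal.add_lt_add_left ENNReal.ofReal_ne_top (hk1.trans hk2)
  rw [← hint] at h1
  refine absurd h1 (not_lt.2 ?_)
  gcongr
  exact le_mul_of_one_le_right (zero_le) hcon

end FractionalMoment

/-! ### Functionals of consecutive blocks of innovations -/

section Blocks

variable {Ω : Type*} [MeasurableSpace Ω] {P : Measure Ω} {ε : ℤ → Ω → ℝ}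

/-- The innovations at the times `-m, -m - 1, …`. -/
def pastInnovations (ε : ℤ → Ω → ℝ) (m : ℕ) (ω : Ω) : ℕ → ℝ :=
  fun i => ε (-((m + i : ℕ) : ℤ)) ω

theorem measurable_pastInnovations (hε : ∀ t, Measurable (ε t)) (m : ℕ) :
    Measurable (pastInnovations ε m) :=
  measurable_pi_lambda _ fun _ => hε _

theorem identDistrib_pastInnovations (hε : IsInnovation P ε) (m : ℕ) :
    IdentDistrib (pastInnovations ε m) (pastInnovations ε 0) P P := by
  have hinj : ∀ m : ℕ, Function.Injective fun i : ℕ => -((m + i : ℕ) : ℤ) := fun m i j h => by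
    simp only at h
    omega
  exact IdentDistrib.pi (fun i => (hε.identDistrib _).trans (hε.identDistrib _).symm)
    (hε.indep.precomp (hinj m)) (hε.indep.precomp (hinj 0))

/-- Functionals of the first `N` entries of consecutive blocks of length `N` are independent. -/
theorem lintegral_prod_block_mul (hε : IsInnovation P ε) {N : ℕ} {H G : (ℕ → ℝ) → ℝ≥0∞}
    (hHm : Measurable H) (hGm : Measurable G)
    (hH : ∀ e e' : ℕ → ℝ, (∀ i < N, e i = e' i) → H e = H e') (l : ℕ) :
    ∫⁻ ω, (∏ k ∈ Finset.range l, H (pastInnovations ε (k * N) ω)) *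
        G (pastInnovations ε (l * N) ω) ∂P =
      (∫⁻ ω, ∏ k ∈ Finset.range l, H (pastInnovations ε (k * N) ω) ∂P) *
        ∫⁻ ω, G (pastInnovations ε 0 ω) ∂P := by
  -- The first `l` blocks live on times in `S`; `G` may use the entire remaining past `T`.
  set S : Set ℤ := {t | -((l * N : ℕ) : ℤ) < t} with hS
  set T : Set ℤ := {t | t ≤ -((l * N : ℕ) : ℤ)} with hT
  set M : ℤ → MeasurableSpace Ω := fun t => MeasurableSpace.comap (ε t) inferInstance with hM
  have hMle : ∀ t, M t ≤ ‹MeasurableSpace Ω› := fun t => (hε.measurable t).comap_le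
  have hind : Indep (⨆ t ∈ S, M t) (⨆ t ∈ T, M t) P := by
    refine indep_iSup_of_disjoint hMle ((iIndepFun_iff_iIndep _ _ _).1 hε.indep) ?_
    rw [Set.disjoint_left]
    intro t h1 h2
    exact (not_le.2 (show -((l * N : ℕ) : ℤ) < t from h1)) h2
  have hmeas : ∀ (U : Set ℤ) (t : ℤ), t ∈ U → Measurable[⨆ t ∈ U, M t] (ε t) := fun U t ht =>
    (comap_measurable (ε t)).mono (le_iSup₂_of_le t ht le_rfl) le_rfl
  have hpi : ∀ (m : MeasurableSpace Ω) (f : Ω → ℕ → ℝ), (∀ i, Measurable[m] fun ω => f ω i) →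
      Measurable[m] f := fun m f h => @measurable_pi_lambda _ _ _ m _ f h
  rw [lintegral_mul_eq_lintegral_mul_lintegral_of_independent_measurableSpace
    (iSup₂_le fun t _ => hMle t) (iSup₂_le fun t _ => hMle t) hind]
  · congr 1
    exact ((identDistrib_pastInnovations hε (l * N)).comp hGm).lintegral_eq
  · refine Finset.measurable_fun_prod _ fun k hk => ?_
    -- Zeroing the entries beyond `N`, which `H` ignores, makes measurability with respect to the
    -- times in `S` visible.
    have e : (fun ω => H (pastInnovations ε (k * N) ω)) =
        fun ω => H fun i => if i < N then pastInnovations ε (k * N) ω i else 0 := by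
      funext ω
      exact hH _ _ fun i hi => (if_pos hi).symm
    rw [e]
    refine hHm.comp (hpi _ _ fun i => ?_)
    by_cases hi : i < N
    · simp only [hi, if_true]
      refine hmeas S _ ?_
      have h1 : (k + 1) * N ≤ l * N := Nat.mul_le_mul_right N (Finset.mem_range.1 hk)
      have h2 : (k + 1) * N = k * N + N := by ring
      simp only [hS, Set.mem_ofPred_eq]
      omega
    · simp only [hi, if_false]
      exact measurable_const
  · refine hGm.comp (hpi _ _ fun i => hmeas T _ ?_)
    simp only [hT, Set.mem_ofPred_eq]
    omega

theorem lintegral_prod_block [IsProbabilityMeasure P] (hε : IsInnovation P ε) {N : ℕ}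
    {H : (ℕ → ℝ) → ℝ≥0∞} (hHm : Measurable H)
    (hH : ∀ e e' : ℕ → ℝ, (∀ i < N, e i = e' i) → H e = H e') (l : ℕ) :
    ∫⁻ ω, ∏ k ∈ Finset.range l, H (pastInnovations ε (k * N) ω) ∂P =
      (∫⁻ ω, H (pastInnovations ε 0 ω) ∂P) ^ l := by
  induction l with
  | zero => simp
  | succ l ih =>
    simp_rw [Finset.prod_range_succ]
    rw [lintegral_prod_block_mul hε hHm hHm hH, ih, pow_succ]

theorem lintegral_prod_innovation [IsProbabilityMeasure P] (hε : IsInnovation P ε) {g : ℝ → ℝ≥0∞}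
    (hg : Measurable g) (N : ℕ) :
    ∫⁻ ω, ∏ i ∈ Finset.range N, g (pastInnovations ε 0 ω i) ∂P = (∫⁻ ω, g (ε 0 ω) ∂P) ^ N := by
  have h := lintegral_prod_block hε (N := 1) (H := fun e => g (e 0))
    (hg.comp (measurable_pi_apply 0)) (fun e e' h => by rw [h 0 one_pos]) N
  simpa [pastInnovations] using h

end Blocks

/-! ### The Markovian form of the GARCH recursion -/

section Markov

attribute [local instance] Matrix.linftyOpNormedAddCommGroup

variable {p q : ℕ} {θ : GarchParam p q}

/-- The coefficients of the first rows of `garchMatrix`. -/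
def garchRow (θ : GarchParam p q) : Fin p ⊕ Fin q → ℝ := Sum.elim (fun i => θ.1 i.succ) θ.2

/-- The inhomogeneous term of the Markovian form. -/
def garchShift (θ : GarchParam p q) (e : ℝ) : Fin p ⊕ Fin q → ℝ :=
  Sum.elim (fun i => if (i : ℕ) = 0 then e ^ 2 * θ.1 0 else 0)
    (fun j => if (j : ℕ) = 0 then θ.1 0 else 0)

/-- The state vector of the Markovian form. -/
def garchState (p q : ℕ) (x y : ℤ → ℝ) (t : ℤ) : Fin p ⊕ Fin q → ℝ :=
  Sum.elim (fun i => x (t - i) ^ 2) (fun j => y (t - j) ^ 2)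

/-- The product of the matrices of the Markovian form along a sequence of innovations. -/
def garchProd (θ : GarchParam p q) (e : ℕ → ℝ) (k : ℕ) :
    Matrix (Fin p ⊕ Fin q) (Fin p ⊕ Fin q) ℝ :=
  ((List.range k).map fun i => garchMatrix θ (e i)).prod

theorem garchProd_zero (θ : GarchParam p q) (e : ℕ → ℝ) : garchProd θ e 0 = 1 := by
  simp [garchProd]

theorem garchProd_succ (θ : GarchParam p q) (e : ℕ → ℝ) (k : ℕ) :
    garchProd θ e (k + 1) = garchProd θ e k * garchMatrix θ (e k) := by
  simp [garchProd, List.range_succ]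

theorem garchProd_congr (θ : GarchParam p q) {e e' : ℕ → ℝ} {k : ℕ} (h : ∀ i < k, e i = e' i) :
    garchProd θ e k = garchProd θ e' k := by
  induction k with
  | zero => rw [garchProd_zero, garchProd_zero]
  | succ k ih =>
    rw [garchProd_succ, garchProd_succ, ih fun i hi => h i (by omega), h k (by omega)]

theorem continuous_garchMatrix_apply (θ : GarchParam p q) (i j : Fin p ⊕ Fin q) :
    Continuous fun e => garchMatrix θ e i j := by
  rcases i with i | i <;> simp only [garchMatrix] <;> split_ifs <;> fun_prop

theorem measurable_garchProd_apply (θ : GarchParam p q) (k : ℕ) (i j : Fin p ⊕ Fin q) :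
    Measurable fun e => garchProd θ e k i j := by
  induction k generalizing i j with
  | zero => simp_rw [garchProd_zero]; exact measurable_const
  | succ k ih =>
    simp_rw [garchProd_succ, Matrix.mul_apply]
    exact Finset.measurable_fun_sum _ fun l _ => (ih i l).mul
      ((continuous_garchMatrix_apply θ l j).measurable.comp (measurable_pi_apply k))

theorem measurable_norm_garchProd (θ : GarchParam p q) (k : ℕ) :
    Measurable fun e => ‖garchProd θ e k‖ := by
  simp_rw [Matrix.linfty_opNorm_def]
  refine measurable_coe_nnreal_real.comp ?_
  have h : ∀ i, Measurable fun e => ∑ j, ‖garchProd θ e k i j‖₊ := fun i =>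
    Finset.measurable_fun_sum _ fun j _ => (measurable_garchProd_apply θ k i j).nnnorm
  suffices ∀ s : Finset (Fin p ⊕ Fin q), Measurable fun e =>
      s.sup fun i => ∑ j, ‖garchProd θ e k i j‖₊ from this Finset.univ
  intro s
  induction s using Finset.cons_induction with
  | empty => simp only [Finset.sup_empty]; exact measurable_const
  | cons i s hi ih => simp only [Finset.sup_cons]; exact (h i).sup ih

theorem abs_garchMatrix_apply_le (θ : GarchParam p q) (e : ℝ) (i j : Fin p ⊕ Fin q) :
    |garchMatrix θ e i j| ≤ (1 + ∑ c, |garchRow θ c|) * (1 + e ^ 2) := by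
  have h1 : |garchRow θ j| ≤ ∑ c, |garchRow θ c| :=
    Finset.single_le_sum (f := fun c => |garchRow θ c|) (fun _ _ => abs_nonneg _)
      (Finset.mem_univ j)
  have h0 := abs_nonneg (garchRow θ j)
  have he := sq_nonneg e
  have hrow : ∀ c, Sum.elim (fun i : Fin p => θ.1 i.succ) θ.2 c = garchRow θ c := fun _ => rfl
  rcases i with i | i <;> simp only [garchMatrix] <;> split_ifs <;>
    simp only [hrow, abs_mul, abs_one, abs_zero, abs_of_nonneg he] <;> nlinarith

/-- Entries are affine in `e²`. Requiring `1 ≤ C` makes products of these bounds nondecreasing in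
the number of factors. -/
theorem exists_garch_bound (θ : GarchParam p q) : ∃ C : ℝ, 1 ≤ C ∧ ∀ e,
    ‖garchMatrix θ e‖ ≤ C * (1 + e ^ 2) ∧ ‖garchShift θ e‖ ≤ C * (1 + e ^ 2) := by
  set S := 1 + ∑ c, |garchRow θ c| with hS
  have hS1 : 1 ≤ S := by
    have : 0 ≤ ∑ c, |garchRow θ c| := Finset.sum_nonneg fun _ _ => abs_nonneg _
    linarith
  set m : ℝ := (Fintype.card (Fin p ⊕ Fin q) : ℝ) with hm
  have hm0 : 0 ≤ m := Nat.cast_nonneg _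
  have hα := abs_nonneg (θ.1 0)
  refine ⟨1 + m * S + |θ.1 0|, by nlinarith [mul_nonneg hm0 (zero_le_one.trans hS1)],
    fun e => ⟨?_, ?_⟩⟩
  · have he := sq_nonneg e
    have hb : (0 : ℝ) ≤ m * S * (1 + e ^ 2) := by positivity
    refine le_trans ?_ (show m * S * (1 + e ^ 2) ≤ _ by nlinarith)
    rw [Matrix.linfty_opNorm_def, ← NNReal.coe_mk _ hb, NNReal.coe_le_coe]
    refine Finset.sup_le fun i _ => ?_
    rw [← NNReal.coe_le_coe, NNReal.coe_sum, NNReal.coe_mk]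
    simp only [coe_nnnorm, Real.norm_eq_abs]
    refine (Finset.sum_le_sum fun j _ => abs_garchMatrix_apply_le θ e i j).trans_eq ?_
    rw [Finset.sum_const, Finset.card_univ, nsmul_eq_mul, ← hS, ← hm]
    ring
  · have he := sq_nonneg e
    have hmS : 0 ≤ m * S := by positivity
    refine (pi_norm_le_iff_of_nonneg (by positivity)).2 fun i => ?_
    rcases i with i | i <;> simp only [garchShift, Sum.elim_inl, Sum.elim_inr] <;> split_ifs <;>
      simp only [Real.norm_eq_abs, abs_mul, abs_zero, abs_of_nonneg he] <;>
      nlinarith [mul_nonneg hmS he, mul_nonneg hα he]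

/-- The GARCH equations in Markovian form. -/
theorem garchState_eq {x y e : ℤ → ℝ} (hx : ∀ t, x t = y t * e t)
    (hy : ∀ t, y t ^ 2 = θ.1 0 + ∑ i : Fin p, θ.1 i.succ * x (t - ((i : ℤ) + 1)) ^ 2 +
      ∑ j : Fin q, θ.2 j * y (t - ((j : ℤ) + 1)) ^ 2) (t : ℤ) :
    garchState p q x y t =
      (garchMatrix θ (e t)).mulVec (garchState p q x y (t - 1)) + garchShift θ (e t) := by
  have hrow : y t ^ 2 = θ.1 0 + ∑ c, garchRow θ c * garchState p q x y (t - 1) c := by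
    rw [hy, Fintype.sum_sum_type]
    simp only [garchRow, garchState, Sum.elim_inl, Sum.elim_inr]
    have : ∀ n : ℤ, t - (n + 1) = t - 1 - n := fun n => by ring
    simp_rw [this]
    ring
  have hcoef : ∀ c, Sum.elim (fun i : Fin p => θ.1 i.succ) θ.2 c = garchRow θ c := fun _ => rfl
  funext r
  rw [Pi.add_apply, Matrix.mulVec, dotProduct]
  rcases r with i | j
  · by_cases hi : (i : ℕ) = 0
    · simp only [garchMatrix, hi, if_true, garchShift, Sum.elim_inl, hcoef]
      simp_rw [mul_assoc]
      rw [← Finset.mul_sum]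
      simp only [garchState, Sum.elim_inl, hi, Nat.cast_zero, sub_zero]
      rw [hx, mul_pow, hrow]
      simp only [garchState]
      ring
    · simp only [garchMatrix, hi, if_false, garchShift, Sum.elim_inl, add_zero]
      rw [Finset.sum_eq_single (Sum.inl ⟨(i : ℕ) - 1, by omega⟩)]
      · rw [if_pos ⟨_, rfl, by simp only; omega⟩, one_mul]
        simp only [garchState, Sum.elim_inl]
        congr 2
        omega
      · intro c _ hc
        rw [if_neg, zero_mul]
        rintro ⟨i', rfl, h⟩
        exact hc (congrArg Sum.inl (Fin.ext (by simp only; omega)))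
      · intro h; exact absurd (Finset.mem_univ _) h
  · by_cases hj : (j : ℕ) = 0
    · simp only [garchMatrix, hj, if_true, garchShift, Sum.elim_inr, hcoef]
      simp only [garchState, Sum.elim_inr, hj, Nat.cast_zero, sub_zero]
      rw [hrow]
      simp only [garchState]
      ring
    · simp only [garchMatrix, hj, if_false, garchShift, Sum.elim_inr, add_zero]
      rw [Finset.sum_eq_single (Sum.inr ⟨(j : ℕ) - 1, by omega⟩)]
      · rw [if_pos ⟨_, rfl, by simp only; omega⟩, one_mul]
        simp only [garchState, Sum.elim_inr]
        congr 2
        omega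
      · intro c _ hc
        rw [if_neg, zero_mul]
        rintro ⟨i', rfl, h⟩
        exact hc (congrArg Sum.inr (Fin.ext (by simp only; omega)))
      · intro h; exact absurd (Finset.mem_univ _) h

/-- Iterating a random affine recursion whose coefficients are dominated by `C (1 + e²)`. -/
theorem norm_sub_garchProd_mulVec_le {C : ℝ} (hC1 : 1 ≤ C)
    (hC : ∀ e, ‖garchMatrix θ e‖ ≤ C * (1 + e ^ 2) ∧ ‖garchShift θ e‖ ≤ C * (1 + e ^ 2))
    {Y : ℕ → Fin p ⊕ Fin q → ℝ} {e : ℕ → ℝ}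
    (hY : ∀ k, Y k = (garchMatrix θ (e k)).mulVec (Y (k + 1)) + garchShift θ (e k)) (k : ℕ) :
    ‖Y 0 - (garchProd θ e k).mulVec (Y k)‖ ≤ k * ∏ i ∈ Finset.range k, C * (1 + e i ^ 2) := by
  -- With all factors at least 1, each of the `k` terms of the iterated shift is bounded by the full
  -- product.
  have hg : ∀ i, 1 ≤ C * (1 + e i ^ 2) := fun i => by nlinarith [sq_nonneg (e i)]
  have hprod : ∀ k, ∀ v : Fin p ⊕ Fin q → ℝ, ‖(garchProd θ e k).mulVec v‖ ≤
      (∏ i ∈ Finset.range k, C * (1 + e i ^ 2)) * ‖v‖ := by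
    intro k
    induction k with
    | zero => intro v; simp [garchProd_zero]
    | succ k ih =>
      intro v
      rw [garchProd_succ, ← Matrix.mulVec_mulVec, Finset.prod_range_succ, mul_assoc]
      refine (ih _).trans (mul_le_mul_of_nonneg_left ?_
        (Finset.prod_nonneg fun i _ => zero_le_one.trans (hg i)))
      exact (Matrix.linfty_opNorm_mulVec _ _).trans
        (mul_le_mul_of_nonneg_right (hC _).1 (norm_nonneg _))
  induction k with
  | zero => simp [garchProd_zero]
  | succ k ih =>
    set Q := ∏ i ∈ Finset.range k, C * (1 + e i ^ 2) with hQ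
    have hQ0 : 0 ≤ Q := Finset.prod_nonneg fun i _ => zero_le_one.trans (hg i)
    have e1 : Y 0 - (garchProd θ e (k + 1)).mulVec (Y (k + 1)) =
        (Y 0 - (garchProd θ e k).mulVec (Y k)) +
          (garchProd θ e k).mulVec (garchShift θ (e k)) := by
      rw [hY k, Matrix.mulVec_add, garchProd_succ, Matrix.mulVec_mulVec]
      abel
    rw [e1, Finset.prod_range_succ, ← hQ]
    refine (norm_add_le _ _).trans ((add_le_add ih (hprod k _)).trans ?_)
    have h1 := hg k
    have h2 := mul_le_mul_of_nonneg_left (hC (e k)).2 hQ0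
    push_cast
    have h3 : (k : ℝ) * Q ≤ k * (Q * (C * (1 + e k ^ 2))) :=
      mul_le_mul_of_nonneg_left (le_mul_of_one_le_right hQ0 h1) (Nat.cast_nonneg k)
    linarith

/-- The right side is a product of independent integrable variables, so the norm gets a finite mean,
as `exists_lintegral_rpow_lt_one` requires. -/
theorem norm_garchProd_le {C : ℝ} (hC1 : 1 ≤ C)
    (hC : ∀ e, ‖garchMatrix θ e‖ ≤ C * (1 + e ^ 2)) (e : ℕ → ℝ) (k : ℕ) :
    ‖garchProd θ e (k + 1)‖ ≤ ∏ i ∈ Finset.range (k + 1), C * (1 + e i ^ 2) := by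
  induction k with
  | zero => simpa [garchProd_succ, garchProd_zero] using hC (e 0)
  | succ k ih =>
    rw [garchProd_succ, Finset.prod_range_succ]
    exact (Matrix.linfty_opNorm_mul _ _).trans (mul_le_mul ih (hC _) (norm_nonneg _)
      (Finset.prod_nonneg fun i _ => by nlinarith [sq_nonneg (e i)]))

end Markov

/-! ### Fractional moments of a stationary GARCH process -/

section Moments

attribute [local instance] Matrix.linftyOpNormedAddCommGroup

variable {Ω : Type*} [MeasurableSpace Ω] {P : Measure Ω} {p q : ℕ} {θ : GarchParam p q}
  {ε X σ : ℤ → Ω → ℝ}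

theorem IsInnovation.lintegral_sq_ne_top (hε : IsInnovation P ε) :
    ∫⁻ ω, ENNReal.ofReal (ε 0 ω ^ 2) ∂P ≠ ⊤ :=
  hε.memLp.integrable_sq.lintegral_lt_top.ne

theorem IsInnovation.lintegral_sq_eq (hε : IsInnovation P ε) (t : ℤ) :
    ∫⁻ ω, ENNReal.ofReal (ε t ω ^ 2) ∂P = ∫⁻ ω, ENNReal.ofReal (ε 0 ω ^ 2) ∂P :=
  ((hε.identDistrib t).comp (u := fun x => ENNReal.ofReal (x ^ 2)) (by fun_prop)).lintegral_eq

theorem rpow_le_one_add {x s : ℝ} (hx : 0 ≤ x) (hs : 0 ≤ s) (hs1 : s ≤ 1) : x ^ s ≤ 1 + x := by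
  rcases le_total x 1 with h | h
  · exact (Real.rpow_le_one hx h hs).trans (by linarith)
  · calc x ^ s ≤ x ^ (1 : ℝ) := Real.rpow_le_rpow_of_exponent_le h hs1
      _ = x := Real.rpow_one x
      _ ≤ _ := by linarith

theorem rpow_eq_rpow_half_sq {c s : ℝ} (hc : 0 ≤ c) : c ^ s = (c ^ (s / 2)) ^ 2 := by
  rw [← Real.rpow_natCast, ← Real.rpow_mul hc]
  congr 1
  push_cast
  ring

/-- By AM-GM, halving the exponent bounds a moment of a product without any independence of the
factors. -/
theorem mul_rpow_half_le {a b s : ℝ} (ha : 0 ≤ a) (hb : 0 ≤ b) :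
    (a * b) ^ (s / 2) ≤ a ^ s + b ^ s := by
  rw [Real.mul_rpow ha hb, rpow_eq_rpow_half_sq (s := s) ha, rpow_eq_rpow_half_sq (s := s) hb]
  nlinarith [sq_nonneg (a ^ (s / 2) - b ^ (s / 2)), sq_nonneg (a ^ (s / 2)),
    sq_nonneg (b ^ (s / 2))]

theorem lintegral_prod_bound_ne_top [IsProbabilityMeasure P] (hε : IsInnovation P ε) {C : ℝ}
    (hC : 0 ≤ C) (N : ℕ) :
    ∫⁻ ω, ENNReal.ofReal (∏ i ∈ Finset.range N, C * (1 + pastInnovations ε 0 ω i ^ 2)) ∂P ≠ ⊤ := by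
  have h1 : ∀ ω, ENNReal.ofReal (∏ i ∈ Finset.range N, C * (1 + pastInnovations ε 0 ω i ^ 2)) =
      ∏ i ∈ Finset.range N, ENNReal.ofReal (C * (1 + pastInnovations ε 0 ω i ^ 2)) := fun ω =>
    ENNReal.ofReal_prod_of_nonneg fun i _ => by positivity
  simp_rw [h1]
  rw [lintegral_prod_innovation hε (g := fun x => ENNReal.ofReal (C * (1 + x ^ 2))) (by fun_prop)]
  refine ENNReal.pow_ne_top ?_
  simp_rw [ENNReal.ofReal_mul hC, ENNReal.ofReal_add zero_le_one (sq_nonneg _)]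
  have hm := hε.measurable 0
  rw [lintegral_const_mul _ (by fun_prop), lintegral_add_left (by fun_prop)]
  refine ENNReal.mul_ne_top ENNReal.ofReal_ne_top (ENNReal.add_ne_top.2 ⟨?_, ?_⟩)
  · simp
  · exact hε.lintegral_sq_ne_top

/-- A negative Lyapunov exponent makes some product of consecutive matrices a contraction in
`s`-th mean. -/
theorem exists_garchProd_contraction [IsProbabilityMeasure P] (hε : IsInnovation P ε)
    (hl : garchLyapunov P θ ε < 0) :
    ∃ (N : ℕ) (s : ℝ), 0 < s ∧ s ≤ 1 ∧
      ∫⁻ ω, ENNReal.ofReal (‖garchProd θ (pastInnovations ε 0 ω) N‖ ^ s) ∂P < 1 := by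
  obtain ⟨C, hC1, hC⟩ := exists_garch_bound θ
  -- The exponent is an infimum, so a single block length `m + 1` already has negative logarithmic
  -- mean; no ergodic theorem is needed.
  rw [garchLyapunov, iInf_lt_iff] at hl
  obtain ⟨m, hm⟩ := hl
  have hN : Measurable fun ω => ‖garchProd θ (pastInnovations ε 0 ω) (m + 1)‖ :=
    (measurable_norm_garchProd θ (m + 1)).comp (measurable_pastInnovations hε.measurable 0)
  have hprod : ∀ ω, ((List.range (m + 1)).map (fun i : ℕ => garchMatrix θ (ε (-(i : ℤ)) ω))).prod =
      garchProd θ (pastInnovations ε 0 ω) (m + 1) := fun ω => by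
    simp only [garchProd, pastInnovations, zero_add]
  simp_rw [hprod] at hm
  refine ⟨m + 1, exists_lintegral_rpow_lt_one hN (fun ω => norm_nonneg _) ?_ ?_⟩
  · refine ((lintegral_mono fun ω => ENNReal.ofReal_le_ofReal
      (norm_garchProd_le hC1 (fun e => (hC e).1) _ m)).trans_lt ?_).ne
    exact (lintegral_prod_bound_ne_top hε (zero_le_one.trans hC1) _).lt_top
  · by_contra hcon
    push Not at hcon
    exact absurd hm (not_lt.2 (EReal.div_nonneg hcon (by exact_mod_cast Nat.zero_le _)))

/-- The pathwise form of the model: all its equations hold simultaneously. -/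
theorem IsStationaryGarch.ae_equations (hX : IsStationaryGarch P θ ε X σ) :
    ∀ᵐ ω ∂P, (∀ t, 0 ≤ σ t ω) ∧ (∀ t, X t ω = σ t ω * ε t ω) ∧
      ∀ t, σ t ω ^ 2 = θ.1 0 + ∑ i : Fin p, θ.1 i.succ * X (t - ((i : ℤ) + 1)) ω ^ 2 +
        ∑ j : Fin q, θ.2 j * σ (t - ((j : ℤ) + 1)) ω ^ 2 := by
  filter_upwards [ae_all_iff.2 hX.nonneg_σ, ae_all_iff.2 hX.observation,
    ae_all_iff.2 hX.volatility] with ω h1 h2 h3 using ⟨h1, h2, h3⟩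

theorem measurable_garchState_path (t : ℤ) :
    Measurable fun z : ℤ → ℝ × ℝ => garchState p q (fun s => (z s).1) (fun s => (z s).2) t := by
  refine measurable_pi_lambda _ fun r => ?_
  rcases r with i | j <;> simp only [garchState, Sum.elim_inl, Sum.elim_inr] <;> fun_prop

theorem IsStationaryGarch.identDistrib_garchState (hX : IsStationaryGarch P θ ε X σ) (t : ℤ) :
    IdentDistrib (fun ω => garchState p q (fun s => X s ω) (fun s => σ s ω) t)
      (fun ω => garchState p q (fun s => X s ω) (fun s => σ s ω) 0) P P := by
  have h := (hX.stationary t).comp (measurable_garchState_path (p := p) (q := q) 0)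
  convert! h using 2 with ω
  · funext ω
    simp [garchState, add_comm, sub_eq_add_neg]

/-- Observe the state at the times `-kN`: one step back multiplies by an independent block product
whose `s`-th power has mean below 1. For `s ≤ 1` the power is subadditive, so `‖Y‖ ^ s` obeys the
scalar recursion. -/
theorem IsStationaryGarch.lintegral_garchState_ne_top [IsProbabilityMeasure P]
    (hε : IsInnovation P ε) (hX : IsStationaryGarch P θ ε X σ) :
    ∃ s : ℝ, 0 < s ∧ s ≤ 1 ∧ ∫⁻ ω, ENNReal.ofReal
      (‖garchState p q (fun t => X t ω) (fun t => σ t ω) 0‖ ^ s) ∂P ≠ ⊤ := by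
  obtain ⟨C, hC1, hC⟩ := exists_garch_bound θ
  obtain ⟨N, s, hs, hs1, hκ⟩ := exists_garchProd_contraction hε hX.lyapunov
  refine ⟨s, hs, hs1, ?_⟩
  set Y : ℤ → Ω → Fin p ⊕ Fin q → ℝ := fun t ω =>
    garchState p q (fun t => X t ω) (fun t => σ t ω) t with hY
  set H : (ℕ → ℝ) → ℝ≥0∞ := fun e => ENNReal.ofReal (‖garchProd θ e N‖ ^ s) with hH
  set G : (ℕ → ℝ) → ℝ≥0∞ := fun e =>
    ENNReal.ofReal ((N * ∏ i ∈ Finset.range N, C * (1 + e i ^ 2)) ^ s) with hG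
  have hnormpow : Measurable fun v : Fin p ⊕ Fin q → ℝ => ENNReal.ofReal (‖v‖ ^ s) := by fun_prop
  have hYid : ∀ t, IdentDistrib (Y t) (Y 0) P P := hX.identDistrib_garchState
  have hYm : ∀ t, Measurable (Y t) := fun t => by
    refine (measurable_garchState_path (p := p) (q := q) t).comp
      (g := fun z : ℤ → ℝ × ℝ => garchState p q (fun s => (z s).1) (fun s => (z s).2) t)
      (f := fun ω s => (X s ω, σ s ω)) (measurable_pi_lambda _ fun s => ?_)
    exact (hX.measurable_X s).prodMk (hX.measurable_σ s)
  have hHm : Measurable H :=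
    ((measurable_norm_garchProd θ N).pow_const s).ennreal_ofReal
  have hGm : Measurable G := by fun_prop
  have hpm := fun m => measurable_pastInnovations (ε := ε) hε.measurable m
  have hdep : ∀ e e' : ℕ → ℝ, (∀ i < N, e i = e' i) → H e = H e' := fun e e' h => by
    simp only [hH, garchProd_congr θ h]
  have hprod := lintegral_prod_block hε hHm hdep
  have hprodG := lintegral_prod_block_mul hε hHm hGm hdep
  have hrec : ∀ k : ℕ, ∀ᵐ ω ∂P, ENNReal.ofReal (‖Y (-((k * N : ℕ) : ℤ)) ω‖ ^ s) ≤
      H (pastInnovations ε (k * N) ω) * ENNReal.ofReal (‖Y (-(((k + 1) * N : ℕ) : ℤ)) ω‖ ^ s) +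
        G (pastInnovations ε (k * N) ω) := by
    intro k
    filter_upwards [hX.ae_equations] with ω ⟨_, h2, h3⟩
    have h4 := norm_sub_garchProd_mulVec_le hC1 hC
      (Y := fun i => Y (-((k * N + i : ℕ) : ℤ)) ω) (e := pastInnovations ε (k * N) ω) (by
        intro i
        have h5 := garchState_eq (θ := θ) (e := fun t => ε t ω) h2 h3 (-((k * N + i : ℕ) : ℤ))
        have h6 : -((k * N + i : ℕ) : ℤ) - 1 = -((k * N + (i + 1) : ℕ) : ℤ) := by omega
        rw [h6] at h5
        exact h5) N
    simp only [add_zero] at h4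
    rw [show k * N + N = (k + 1) * N by ring] at h4
    set y := Y (-((k * N : ℕ) : ℤ)) ω
    set y' := Y (-(((k + 1) * N : ℕ) : ℤ)) ω
    set e := pastInnovations ε (k * N) ω
    set B := (N : ℝ) * ∏ i ∈ Finset.range N, C * (1 + e i ^ 2) with hB
    have hB0 : 0 ≤ B := mul_nonneg (Nat.cast_nonneg _) (Finset.prod_nonneg fun i _ => by positivity)
    have h7 : ‖y‖ ≤ ‖garchProd θ e N‖ * ‖y'‖ + B := by
      have := Matrix.linfty_opNorm_mulVec (garchProd θ e N) y'
      have h8 := norm_le_norm_add_norm_sub' y ((garchProd θ e N).mulVec y')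
      linarith
    have h9 : ‖y‖ ^ s ≤ ‖garchProd θ e N‖ ^ s * ‖y'‖ ^ s + B ^ s :=
      calc ‖y‖ ^ s ≤ (‖garchProd θ e N‖ * ‖y'‖ + B) ^ s :=
            Real.rpow_le_rpow (norm_nonneg _) h7 hs.le
        _ ≤ (‖garchProd θ e N‖ * ‖y'‖) ^ s + B ^ s :=
            Real.rpow_add_le_add_rpow (by positivity) hB0 hs.le hs1
        _ = _ := by rw [Real.mul_rpow (norm_nonneg _) (norm_nonneg _)]
    calc ENNReal.ofReal (‖y‖ ^ s) ≤ ENNReal.ofReal (‖garchProd θ e N‖ ^ s * ‖y'‖ ^ s + B ^ s) :=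
          ENNReal.ofReal_le_ofReal h9
      _ = _ := by
          rw [ENNReal.ofReal_add (by positivity) (by positivity),
            ENNReal.ofReal_mul (by positivity)]
  have hGfin : ∫⁻ ω, G (pastInnovations ε 0 ω) ∂P ≠ ⊤ := by
    have h1 : ∀ ω, G (pastInnovations ε 0 ω) ≤ 1 + ENNReal.ofReal N * ENNReal.ofReal
        (∏ i ∈ Finset.range N, C * (1 + pastInnovations ε 0 ω i ^ 2)) := fun ω => by
      have h0 : 0 ≤ ∏ i ∈ Finset.range N, C * (1 + pastInnovations ε 0 ω i ^ 2) :=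
        Finset.prod_nonneg fun i _ => by positivity
      rw [← ENNReal.ofReal_mul (Nat.cast_nonneg _), ← ENNReal.ofReal_one,
        ← ENNReal.ofReal_add zero_le_one (mul_nonneg (Nat.cast_nonneg _) h0)]
      exact ENNReal.ofReal_le_ofReal
        (rpow_le_one_add (mul_nonneg (Nat.cast_nonneg _) h0) hs.le hs1)
    refine ((lintegral_mono h1).trans_lt ?_).ne
    rw [lintegral_add_left measurable_const, lintegral_const_mul' _ _ ENNReal.ofReal_ne_top]
    refine ENNReal.add_lt_top.2 ⟨by simp, ENNReal.mul_lt_top ENNReal.ofReal_lt_top ?_⟩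
    exact (lintegral_prod_bound_ne_top hε (zero_le_one.trans hC1) N).lt_top
  have hmain := lintegral_le_of_stochastic_recursion (P := P)
    (z := fun k ω => ENNReal.ofReal (‖Y (-((k * N : ℕ) : ℤ)) ω‖ ^ s))
    (a := fun k ω => H (pastInnovations ε (k * N) ω))
    (d := fun k ω => G (pastInnovations ε (k * N) ω))
    (fun k => hnormpow.comp (hYm _)) (fun k => hHm.comp (hpm _)) (fun k => hGm.comp (hpm _))
    (fun k => ((hYid _).trans (hYid _).symm).comp hnormpow)
    (Eventually.of_forall fun ω => ENNReal.ofReal_ne_top) hrec hκ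
    (fun l => (hprod l).le) (fun l => by rw [hprodG l, hprod l])
  simp only [zero_mul, Nat.cast_zero, neg_zero] at hmain
  refine (hmain.trans_lt (ENNReal.mul_lt_top ?_ hGfin.lt_top)).ne
  exact ENNReal.inv_lt_top.2 (tsub_pos_of_lt hκ)

/-- A stationary GARCH process has a finite fractional moment. -/
theorem IsStationaryGarch.exists_moment [IsProbabilityMeasure P] (hε : IsInnovation P ε)
    (hX : IsStationaryGarch P θ ε X σ) :
    ∃ s : ℝ, 0 < s ∧ s ≤ 1 ∧ ∃ D : ℝ≥0∞, D ≠ ⊤ ∧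
      ∀ t, ∫⁻ ω, ENNReal.ofReal ((X t ω ^ 2) ^ s) ∂P ≤ D := by
  obtain ⟨s, hs, hs1, hfin⟩ := hX.lintegral_garchState_ne_top hε
  set A := ∑ c, |garchRow θ c| with hA
  have hA0 : 0 ≤ A := Finset.sum_nonneg fun _ _ => abs_nonneg _
  set Y : ℤ → Ω → Fin p ⊕ Fin q → ℝ := fun t ω =>
    garchState p q (fun t => X t ω) (fun t => σ t ω) t with hY
  have hnormpow : Measurable fun v : Fin p ⊕ Fin q → ℝ => ENNReal.ofReal (‖v‖ ^ s) := by fun_prop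
  refine ⟨s / 2, by positivity, by linarith, ENNReal.ofReal (|θ.1 0| ^ s) +
    ENNReal.ofReal (A ^ s) * ∫⁻ ω, ENNReal.ofReal (‖Y 0 ω‖ ^ s) ∂P +
      (1 + ∫⁻ ω, ENNReal.ofReal (ε 0 ω ^ 2) ∂P), ?_, fun t => ?_⟩
  · exact ENNReal.add_ne_top.2 ⟨ENNReal.add_ne_top.2 ⟨ENNReal.ofReal_ne_top,
      ENNReal.mul_ne_top ENNReal.ofReal_ne_top hfin⟩,
      ENNReal.add_ne_top.2 ⟨ENNReal.one_ne_top, hε.lintegral_sq_ne_top⟩⟩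
  · have hpt : ∀ᵐ ω ∂P, ENNReal.ofReal ((X t ω ^ 2) ^ (s / 2)) ≤ ENNReal.ofReal (|θ.1 0| ^ s) +
        ENNReal.ofReal (A ^ s) * ENNReal.ofReal (‖Y (t - 1) ω‖ ^ s) +
          (1 + ENNReal.ofReal (ε t ω ^ 2)) := by
      filter_upwards [hX.ae_equations] with ω ⟨_, h2, h3⟩
      -- Going through `σ_t²` and the previous state also covers `p = 0`, where no `X²` is a
      -- coordinate of the state.
      have hrow : σ t ω ^ 2 = θ.1 0 + ∑ c, garchRow θ c * Y (t - 1) ω c := by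
        rw [h3, Fintype.sum_sum_type]
        simp only [hY, garchRow, garchState, Sum.elim_inl, Sum.elim_inr]
        have : ∀ n : ℤ, t - (n + 1) = t - 1 - n := fun n => by ring
        simp_rw [this]
        ring
      have hsum : ∑ c, garchRow θ c * Y (t - 1) ω c ≤ A * ‖Y (t - 1) ω‖ := by
        rw [hA, Finset.sum_mul]
        refine Finset.sum_le_sum fun c _ => (le_abs_self _).trans ?_
        rw [abs_mul]
        exact mul_le_mul_of_nonneg_left (norm_le_pi_norm (Y (t - 1) ω) c) (abs_nonneg _)
      have hσ : σ t ω ^ 2 ≤ |θ.1 0| + A * ‖Y (t - 1) ω‖ := by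
        rw [hrow]; exact add_le_add (le_abs_self _) hsum
      have h4 : (X t ω ^ 2) ^ (s / 2) ≤
          |θ.1 0| ^ s + A ^ s * ‖Y (t - 1) ω‖ ^ s + (1 + ε t ω ^ 2) := by
        rw [h2, mul_pow]
        refine (mul_rpow_half_le (sq_nonneg _) (sq_nonneg _)).trans (add_le_add ?_ ?_)
        · calc (σ t ω ^ 2) ^ s ≤ (|θ.1 0| + A * ‖Y (t - 1) ω‖) ^ s :=
                Real.rpow_le_rpow (sq_nonneg _) hσ hs.le
            _ ≤ |θ.1 0| ^ s + (A * ‖Y (t - 1) ω‖) ^ s :=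
                Real.rpow_add_le_add_rpow (abs_nonneg _) (by positivity) hs.le hs1
            _ = _ := by rw [Real.mul_rpow hA0 (norm_nonneg _)]
        · exact rpow_le_one_add (sq_nonneg _) hs.le hs1
      refine (ENNReal.ofReal_le_ofReal h4).trans_eq ?_
      rw [ENNReal.ofReal_add (by positivity) (by positivity),
        ENNReal.ofReal_add (by positivity) (by positivity), ENNReal.ofReal_mul (by positivity),
        ENNReal.ofReal_add (by positivity) (by positivity), ENNReal.ofReal_one]
    refine (lintegral_mono_ae hpt).trans_eq ?_
    have hmt : Measurable (ε t) := hε.measurable t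
    have hY0 : ∫⁻ ω, ENNReal.ofReal (‖Y (t - 1) ω‖ ^ s) ∂P =
        ∫⁻ ω, ENNReal.ofReal (‖Y 0 ω‖ ^ s) ∂P :=
      ((hX.identDistrib_garchState (t - 1)).comp hnormpow).lintegral_eq
    rw [lintegral_add_right _ (by fun_prop), lintegral_add_left measurable_const,
      lintegral_add_left measurable_const, lintegral_const_mul' _ _ ENNReal.ofReal_ne_top,
      hε.lintegral_sq_eq t, hY0]
    simp

end Moments

/-! ### Kernel density estimators based on residuals -/

section Estimation

/-- The bound is free of `x`, which disposes of the supremum; one factor `1 / h` is the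
normalisation, the other comes from rescaling the argument of `K`. -/
theorem abs_kernelDensity_sub_le {K : ℝ → ℝ} {C h : ℝ} (hK : ∀ x y, |K x - K y| ≤ C * |x - y|)
    (hh : 0 < h) (n : ℕ) (e e' : ℕ → ℝ) (x : ℝ) :
    |kernelDensity K h n e x - kernelDensity K h n e' x| ≤
      C / (n * h ^ 2) * ∑ t ∈ Finset.Icc 1 n, |e t - e' t| := by
  rw [kernelDensity, kernelDensity, ← mul_sub, ← Finset.sum_sub_distrib, abs_mul,
    abs_of_nonneg (by positivity)]
  have h1 : |∑ t ∈ Finset.Icc 1 n, (K ((x - e t) / h) - K ((x - e' t) / h))| ≤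
      C / h * ∑ t ∈ Finset.Icc 1 n, |e t - e' t| := by
    rw [Finset.mul_sum]
    refine (Finset.abs_sum_le_sum_abs _ _).trans (Finset.sum_le_sum fun t _ => (hK _ _).trans_eq ?_)
    rw [← sub_div, abs_div, abs_of_pos hh, sub_sub_sub_cancel_left, abs_sub_comm]
    ring
  refine (mul_le_mul_of_nonneg_left h1 (by positivity)).trans_eq ?_
  rw [← mul_assoc]
  congr 1
  rw [one_div_mul_eq_div, div_div]
  ring

variable {Ω : Type*} [MeasurableSpace Ω] {P : Measure Ω} {p q : ℕ} {θ : GarchParam p q}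
  {ε X σ : ℤ → Ω → ℝ}

theorem IsInnovation.lintegral_abs_le [IsProbabilityMeasure P] (hε : IsInnovation P ε) (t : ℤ) :
    ∫⁻ ω, ENNReal.ofReal |ε t ω| ∂P ≤ 1 + ∫⁻ ω, ENNReal.ofReal (ε 0 ω ^ 2) ∂P := by
  have h : ∀ ω, ENNReal.ofReal |ε t ω| ≤ 1 + ENNReal.ofReal (ε t ω ^ 2) := fun ω => by
    rw [← ENNReal.ofReal_one, ← ENNReal.ofReal_add zero_le_one (sq_nonneg _)]
    refine ENNReal.ofReal_le_ofReal ?_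
    rw [← sq_abs]
    nlinarith [sq_nonneg (|ε t ω| - 1), sq_nonneg |ε t ω|]
  refine (lintegral_mono h).trans_eq ?_
  rw [lintegral_add_left measurable_const, hε.lintegral_sq_eq t]
  simp

/-- Geometrically weighted sums of innovations are almost surely finite. -/
theorem IsInnovation.ae_tsum_ne_top [IsProbabilityMeasure P] (hε : IsInnovation P ε) {r : ℝ}
    (hr : 0 ≤ r) (hr1 : r < 1) :
    ∀ᵐ ω ∂P, ∑' t : ℕ, ENNReal.ofReal (r ^ t * |ε t ω|) ≠ ⊤ := by
  have hm := hε.measurable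
  have h1 : ∫⁻ ω, ∑' t : ℕ, ENNReal.ofReal (r ^ t * |ε t ω|) ∂P ≠ ⊤ := by
    rw [lintegral_tsum fun t => by fun_prop]
    have h2 : ∀ t : ℕ, ∫⁻ ω, ENNReal.ofReal (r ^ t * |ε t ω|) ∂P ≤
        ENNReal.ofReal r ^ t * (1 + ∫⁻ ω, ENNReal.ofReal (ε 0 ω ^ 2) ∂P) := fun t => by
      simp_rw [ENNReal.ofReal_mul (pow_nonneg hr t), ENNReal.ofReal_pow hr]
      rw [lintegral_const_mul' _ _ (ENNReal.pow_ne_top ENNReal.ofReal_ne_top)]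
      exact mul_le_mul_right (hε.lintegral_abs_le t) _
    refine ((ENNReal.tsum_le_tsum h2).trans_lt ?_).ne
    rw [ENNReal.tsum_mul_right, ENNReal.tsum_geometric]
    refine ENNReal.mul_lt_top (ENNReal.inv_lt_top.2 (tsub_pos_of_lt ?_)) ?_
    · exact ENNReal.ofReal_lt_one.2 hr1
    · exact ENNReal.add_lt_top.2 ⟨ENNReal.one_lt_top, hε.lintegral_sq_ne_top.lt_top⟩
  filter_upwards [ae_lt_top (Measurable.tsum fun t => by fun_prop) h1] with ω hω using hω.ne

/-- The random factors in the linear error bound of the residuals are bounded in mean. -/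
theorem exists_lintegral_abs_mul_sum_le [IsProbabilityMeasure P] (hε : IsInnovation P ε)
    (hXm : ∀ t, Measurable (X t)) {s τ L G : ℝ} (hτ : 0 ≤ τ) (hτ1 : τ < 1) (hL : 0 ≤ L)
    (hG : 0 ≤ G) {D : ℝ≥0∞} (hD : D ≠ ⊤)
    (hmom : ∀ t, ∫⁻ ω, ENNReal.ofReal ((X t ω ^ 2) ^ s) ∂P ≤ D) :
    ∃ W : ℝ≥0∞, W ≠ ⊤ ∧ ∀ t : ℕ, ∫⁻ ω, ENNReal.ofReal (|ε t ω| * (L + G * ∑ i ∈ Finset.range t,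
      ((i + 1 : ℕ) : ℝ) * τ ^ (i + 1) * (X ((t : ℤ) - 1 - i) ω ^ 2) ^ (s / 2))) ∂P ≤ W := by
  set E := ∫⁻ ω, ENNReal.ofReal (ε 0 ω ^ 2) ∂P with hE
  have hEfin : E ≠ ⊤ := hε.lintegral_sq_ne_top
  have hm := hε.measurable
  set w : ℕ → ℝ := fun i => ((i + 1 : ℕ) : ℝ) * τ ^ (i + 1) with hw
  have hw0 : ∀ i, 0 ≤ w i := fun i => by positivity
  have hws : Summable w := by
    have h := summable_pow_mul_geometric_of_norm_lt_one (R := ℝ) 1 (r := τ)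
      (by rwa [Real.norm_of_nonneg hτ])
    simpa [hw] using (summable_nat_add_iff 1).2 h
  have hwfin : ∑' i, ENNReal.ofReal (w i) ≠ ⊤ := by
    rw [← ENNReal.ofReal_tsum_of_nonneg hw0 hws]
    exact ENNReal.ofReal_ne_top
  refine ⟨ENNReal.ofReal L * (1 + E) + ENNReal.ofReal G * ((∑' i, ENNReal.ofReal (w i)) * (E + D)),
    ?_, fun t => ?_⟩
  · exact ENNReal.add_ne_top.2 ⟨ENNReal.mul_ne_top ENNReal.ofReal_ne_top
      (ENNReal.add_ne_top.2 ⟨ENNReal.one_ne_top, hEfin⟩), ENNReal.mul_ne_top ENNReal.ofReal_ne_top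
      (ENNReal.mul_ne_top hwfin (ENNReal.add_ne_top.2 ⟨hEfin, hD⟩))⟩
  have hpt : ∀ ω, ENNReal.ofReal (|ε t ω| * (L + G * ∑ i ∈ Finset.range t,
      w i * (X ((t : ℤ) - 1 - i) ω ^ 2) ^ (s / 2))) ≤ ENNReal.ofReal L * ENNReal.ofReal |ε t ω| +
        ENNReal.ofReal G * ∑ i ∈ Finset.range t, ENNReal.ofReal (w i) *
          (ENNReal.ofReal (ε t ω ^ 2) + ENNReal.ofReal ((X ((t : ℤ) - 1 - i) ω ^ 2) ^ s)) := by
    intro ω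
    -- AM-GM replaces independence of `ε_t` from the earlier `X`, which is not assumed; the exponent
    -- `s / 2` is squared to the available `s`.
    have h1 : ∀ i ∈ Finset.range t, |ε t ω| * (w i * (X ((t : ℤ) - 1 - i) ω ^ 2) ^ (s / 2)) ≤
        w i * (ε t ω ^ 2 + (X ((t : ℤ) - 1 - i) ω ^ 2) ^ s) := by
      intro i _
      set b := (X ((t : ℤ) - 1 - i) ω ^ 2) ^ (s / 2) with hb
      have hb2 : (X ((t : ℤ) - 1 - i) ω ^ 2) ^ s = b ^ 2 :=
        rpow_eq_rpow_half_sq (sq_nonneg _)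
      rw [hb2, ← sq_abs (ε t ω), mul_left_comm]
      refine mul_le_mul_of_nonneg_left ?_ (hw0 i)
      nlinarith [sq_nonneg (|ε t ω| - b), sq_nonneg |ε t ω|, sq_nonneg b]
    have h2 : |ε t ω| * (L + G * ∑ i ∈ Finset.range t,
        w i * (X ((t : ℤ) - 1 - i) ω ^ 2) ^ (s / 2)) ≤ L * |ε t ω| + G * ∑ i ∈ Finset.range t,
          w i * (ε t ω ^ 2 + (X ((t : ℤ) - 1 - i) ω ^ 2) ^ s) := by
      rw [mul_add, mul_comm _ L, mul_left_comm, Finset.mul_sum]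
      exact add_le_add_right (mul_le_mul_of_nonneg_left (Finset.sum_le_sum h1) hG) _
    refine (ENNReal.ofReal_le_ofReal h2).trans_eq ?_
    have h3 : ∀ i, 0 ≤ w i * (ε t ω ^ 2 + (X ((t : ℤ) - 1 - i) ω ^ 2) ^ s) := fun i =>
      mul_nonneg (hw0 i) (by positivity)
    rw [ENNReal.ofReal_add (by positivity) (mul_nonneg hG (Finset.sum_nonneg fun i _ => h3 i)),
      ENNReal.ofReal_mul hL, ENNReal.ofReal_mul hG, ENNReal.ofReal_sum_of_nonneg fun i _ => h3 i]
    congr 2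
    refine Finset.sum_congr rfl fun i _ => ?_
    rw [ENNReal.ofReal_mul (hw0 i), ENNReal.ofReal_add (sq_nonneg _) (by positivity)]
  refine (lintegral_mono hpt).trans ?_
  rw [lintegral_add_left (by fun_prop), lintegral_const_mul' _ _ ENNReal.ofReal_ne_top,
    lintegral_const_mul' _ _ ENNReal.ofReal_ne_top, lintegral_finsetSum _ fun i _ => by fun_prop]
  gcongr
  · exact hε.lintegral_abs_le t
  · calc ∑ i ∈ Finset.range t, ∫⁻ ω, ENNReal.ofReal (w i) *
          (ENNReal.ofReal (ε t ω ^ 2) + ENNReal.ofReal ((X ((t : ℤ) - 1 - i) ω ^ 2) ^ s)) ∂P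
        ≤ ∑ i ∈ Finset.range t, ENNReal.ofReal (w i) * (E + D) := by
          refine Finset.sum_le_sum fun i _ => ?_
          rw [lintegral_const_mul' _ _ ENNReal.ofReal_ne_top, lintegral_add_left (by fun_prop),
            hε.lintegral_sq_eq t]
          gcongr
          exact hmom _
      _ = (∑ i ∈ Finset.range t, ENNReal.ofReal (w i)) * (E + D) := by rw [Finset.sum_mul]
      _ ≤ _ := by gcongr; exact ENNReal.sum_le_tsum _

/-- Markov's inequality for averages. -/
theorem measure_mul_lt_sum_le [IsProbabilityMeasure P] {Z : ℕ → Ω → ℝ} (hZ : ∀ t, Measurable (Z t))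
    (hZ0 : ∀ t ω, 0 ≤ Z t ω) {W η : ℝ≥0∞} (hW : ∀ t, ∫⁻ ω, ENNReal.ofReal (Z t ω) ∂P ≤ W) {M : ℕ}
    (hM0 : M ≠ 0) (hM : W ≤ M * η) {n : ℕ} (hn : n ≠ 0) :
    P {ω | (M : ℝ) * n < ∑ t ∈ Finset.Icc 1 n, Z t ω} ≤ η := by
  have h1 : ∫⁻ ω, ENNReal.ofReal (∑ t ∈ Finset.Icc 1 n, Z t ω) ∂P ≤ n * W := by
    simp_rw [fun ω => ENNReal.ofReal_sum_of_nonneg fun t (_ : t ∈ Finset.Icc 1 n) => hZ0 t ω]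
    rw [lintegral_finsetSum _ fun t _ => (hZ t).ennreal_ofReal]
    refine (Finset.sum_le_sum fun t _ => hW t).trans_eq ?_
    simp
  have h2 : P {ω | (M : ℝ) * n < ∑ t ∈ Finset.Icc 1 n, Z t ω} ≤
      P {ω | ((M * n : ℕ) : ℝ≥0∞) ≤ ENNReal.ofReal (∑ t ∈ Finset.Icc 1 n, Z t ω)} := by
    refine measure_mono fun ω hω => ?_
    have hω' : (M : ℝ) * n < ∑ t ∈ Finset.Icc 1 n, Z t ω := hω
    refine (ENNReal.natCast_le_ofReal (Nat.mul_ne_zero hM0 hn)).2 ?_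
    push_cast
    exact hω'.le
  have h3 := mul_meas_ge_le_lintegral (μ := P)
    (f := fun ω => ENNReal.ofReal (∑ t ∈ Finset.Icc 1 n, Z t ω))
    (Finset.measurable_fun_sum _ fun t _ => hZ t).ennreal_ofReal ((M * n : ℕ) : ℝ≥0∞)
  have h4 : ((M * n : ℕ) : ℝ≥0∞) ≠ 0 := by exact_mod_cast Nat.mul_ne_zero hM0 hn
  refine h2.trans ((ENNReal.mul_le_mul_iff_right h4 (ENNReal.natCast_ne_top _)).1 ?_)
  refine h3.trans (h1.trans ((mul_le_mul_right hM _).trans_eq ?_))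
  push_cast
  ring

end Estimation

end

theorem theorem2p1 {Ω : Type*} [MeasurableSpace Ω] (P : Measure Ω) [IsProbabilityMeasure P]
    -- the model: innovations, parameter in the interior of the parameter space, stationary solution
    (p q : ℕ) (lo hi ρ₀ : ℝ) (hlo : 0 < lo) (hlohi : lo < hi) (hρ₀ : 0 < ρ₀) (hρ₁ : ρ₀ < 1)
    (hqlo : (q : ℝ) * lo < ρ₀)
    (θ : GarchParam p q) (hθ : θ ∈ interior (garchParamSpace p q lo hi ρ₀))
    (ε X σ : ℤ → Ω → ℝ) (hε : IsInnovation P ε) (hX : IsStationaryGarch P θ ε X σ)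
    -- the innovations have little mass near zero, and a finite first moment
    (hsmall : ∃ ζ : ℝ, 0 < ζ ∧
      Tendsto (fun x : ℝ => x ^ (-ζ) * P.real {ω | |ε 0 ω| ≤ x}) (𝓝[>] 0) (𝓝 0))
    (hmoment : Integrable (fun ω => |ε 0 ω|) P)
    -- the root-n consistent estimator
    (θhat : ℕ → Ω → GarchParam p q) (hθhat_meas : ∀ n, Measurable (θhat n))
    (hθhat : IsBigOPOne P (fun n ω => Real.sqrt n * ‖θhat n ω - θ‖))
    -- bandwidth and kernel
    (h : ℕ → ℝ) (hpos : ∀ n, 0 < h n) (hzero : Tendsto h atTop (𝓝 0))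
    (hrate : Tendsto (fun n : ℕ => Real.sqrt n * h n ^ 2) atTop atTop)
    (K : ℝ → ℝ) (hK : IsStdDensity K)
    (hKtail : Tendsto (fun b : ℝ => ⨆ (x : ℝ) (_ : b < |x|), ENNReal.ofReal (|x| * K x))
      atTop (𝓝 0))
    (hKlip : ∃ C : ℝ, ∀ x y : ℝ, |K x - K y| ≤ C * |x - y|) :
    IsLittleOPOne P (fun n ω => ⨆ x : ℝ, ENNReal.ofReal
      |kernelDensity K (h n) n (garchResidual (θhat n ω) (fun t => X t ω)) x -
        kernelDensity K (h n) n (fun t => ε (t : ℤ) ω) x|) := by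
  obtain ⟨C, hC⟩ := hKlip
  have hC0 : 0 ≤ C := by simpa using (abs_nonneg _).trans (hC 1 0)
  have hθΘ : θ ∈ garchParamSpace p q lo hi ρ₀ := interior_subset hθ
  have hhi : 0 < hi := hlo.trans hlohi
  -- the geometric rate of the coefficients
  obtain ⟨r, hr, hr1, hρr⟩ : ∃ r : ℝ, 0 < r ∧ r < 1 ∧ ρ₀ ≤ r ^ (q + 1) :=
    ⟨ρ₀ ^ (((q + 1 : ℕ) : ℝ)⁻¹), Real.rpow_pos_of_pos hρ₀ _,
      Real.rpow_lt_one hρ₀.le hρ₁ (by positivity),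
      (Real.rpow_inv_natCast_pow hρ₀.le (Nat.succ_ne_zero q)).ge⟩
  obtain ⟨s, hs, hs1, D, hD, hmom⟩ := hX.exists_moment hε
  -- `τ` lies strictly between `r ^ (s / 2)` and 1, which leaves room for the factor `1 + ‖u - θ‖ /
  -- lo` when `u` is near `θ`.
  set τ := r ^ (s / 4) with hτ
  have hτ0 : 0 < τ := Real.rpow_pos_of_pos hr _
  have hτ1 : τ < 1 := Real.rpow_lt_one hr.le hr1 (by positivity)
  obtain ⟨ρ, hρ, hball⟩ : ∃ ρ > 0, ∀ u : GarchParam p q, ‖u - θ‖ < ρ →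
      u ∈ garchParamSpace p q lo hi ρ₀ ∧ (1 + ‖u - θ‖ / lo) * r ^ (s / 2) ≤ τ := by
    have h1 : ∀ᶠ u in 𝓝 θ, u ∈ garchParamSpace p q lo hi ρ₀ := mem_interior_iff_mem_nhds.1 hθ
    have h2 : ∀ᶠ u in 𝓝 θ, (1 + ‖u - θ‖ / lo) * r ^ (s / 2) < τ := by
      have hc : Continuous fun u : GarchParam p q => (1 + ‖u - θ‖ / lo) * r ^ (s / 2) := by
        fun_prop
      refine hc.continuousAt.eventually_lt continuousAt_const ?_
      simpa using Real.rpow_lt_rpow_of_exponent_gt hr hr1 (by linarith : s / 4 < s / 2)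
    obtain ⟨ρ, hρ, h3⟩ := Metric.eventually_nhds_iff.1 (h1.and h2)
    refine ⟨ρ, hρ, fun u hu => ?_⟩
    have h4 := h3 (y := u) (by rwa [dist_eq_norm])
    exact ⟨h4.1, h4.2.le⟩
  -- the random factors of the residual errors
  set L := (1 / (1 - ρ₀) + hi * q / (1 - ρ₀) ^ 2) / lo with hL
  set G := (hi / ((1 - r) * r ^ p) / lo) ^ (s / 2) / lo with hG
  have hr' : 0 < 1 - r := by linarith
  have hρ' : 0 < 1 - ρ₀ := by linarith
  have hL0 : 0 ≤ L := by positivity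
  have hG0 : 0 ≤ G := by positivity
  have hεm := hε.measurable
  have hXm := hX.measurable_X
  have hσm := hX.measurable_σ
  set Z : ℕ → Ω → ℝ := fun t ω => |ε t ω| * (L + G * ∑ i ∈ Finset.range t,
    ((i + 1 : ℕ) : ℝ) * τ ^ (i + 1) * (X ((t : ℤ) - 1 - i) ω ^ 2) ^ (s / 2)) with hZ
  have hZm : ∀ t, Measurable (Z t) := fun t => by fun_prop
  have hZ0 : ∀ t ω, 0 ≤ Z t ω := fun t ω => by positivity
  obtain ⟨W, hW, hZW⟩ := exists_lintegral_abs_mul_sum_le hε hXm hτ0.le hτ1 hL0 hG0 hD hmom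
  set R : Ω → ℝ := fun ω => (∑ k ∈ Finset.range (p + q + 1),
    |σ k ω ^ 2 - garchTruncVar θ (fun t => X t ω) k|) / r ^ (p + q + 1) / lo with hR
  have hR0 : ∀ ω, 0 ≤ R ω := fun ω => by positivity
  have hRm : Measurable R := by
    simp only [hR, garchTruncVar]
    fun_prop
  -- Total effect of the starting values over all times: almost surely finite and independent of
  -- `n`.
  set Q : Ω → ℝ≥0∞ := fun ω =>
    ENNReal.ofReal (R ω) * ∑' t : ℕ, ENNReal.ofReal (r ^ t * |ε t ω|) with hQ
  have hQm : Measurable Q :=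
    hRm.ennreal_ofReal.mul (Measurable.tsum fun t => by fun_prop)
  have hQfin : ∀ᵐ ω ∂P, Q ω ≠ ⊤ := by
    filter_upwards [hε.ae_tsum_ne_top hr.le hr1] with ω hω
    exact ENNReal.mul_ne_top ENNReal.ofReal_ne_top hω
  intro δ hδ
  refine ENNReal.tendsto_nhds_zero.2 fun η hη => ?_
  have hη3 : 0 < η / 3 := ENNReal.div_pos hη.ne' (by simp)
  obtain ⟨M₁, hM₁⟩ := hθhat (η / 3) hη3
  obtain ⟨M₂, hM₂⟩ := ((ENNReal.tendsto_nhds_zero.1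
    (tendsto_measure_natCast_lt hQm hQfin)) (η / 3) hη3).exists
  obtain ⟨M₃, hM₃0, hM₃⟩ : ∃ M : ℕ, M ≠ 0 ∧ W ≤ M * (η / 3) := by
    obtain ⟨M, hM⟩ := ENNReal.exists_nat_gt (ENNReal.div_ne_top hW hη3.ne')
    refine ⟨M + 1, M.succ_ne_zero, ENNReal.div_le_iff_le_mul (Or.inl hη3.ne')
      (Or.inr (by exact_mod_cast M.succ_ne_zero)) |>.1 ?_⟩
    exact hM.le.trans (by exact_mod_cast M.le_succ)
  have hsqrt : Tendsto (fun n : ℕ => Real.sqrt n) atTop atTop :=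
    Real.tendsto_sqrt_atTop.comp tendsto_natCast_atTop_atTop
  have hsmall₁ : ∀ᶠ n : ℕ in atTop, M₁ / Real.sqrt n < ρ :=
    (hsqrt.const_div_atTop M₁).eventually_lt_const hρ
  have hsmall₂ : ∀ᶠ n : ℕ in atTop,
      ENNReal.ofReal (C * (M₂ + M₁ * M₃) / (Real.sqrt n * h n ^ 2)) < δ := by
    have h1 := ENNReal.tendsto_ofReal (hrate.const_div_atTop (C * (M₂ + M₁ * M₃)))
    rw [ENNReal.ofReal_zero] at h1
    exact h1.eventually_lt_const hδ
  filter_upwards [hM₁, hsmall₁, hsmall₂, eventually_ge_atTop 1] with n hn₁ hn₂ hn₃ hn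
  have hn0 : (0 : ℝ) < n := by exact_mod_cast hn
  have hsn : 0 < Real.sqrt n := Real.sqrt_pos.2 hn0
  have hsn1 : 1 ≤ Real.sqrt n := Real.one_le_sqrt.2 (by exact_mod_cast hn)
  have hsnn : Real.sqrt n * Real.sqrt n = n := Real.mul_self_sqrt hn0.le
  have hh := hpos n
  -- Off three events of probability at most `η / 3` each, the bound is deterministic. The inclusion
  -- holds almost surely, and monotonicity of `P` needs no measurability of the supremum.
  have hsub : ∀ᵐ ω ∂P, δ < (⨆ x : ℝ, ENNReal.ofReal
      |kernelDensity K (h n) n (garchResidual (θhat n ω) (fun t => X t ω)) x -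
        kernelDensity K (h n) n (fun t => ε (t : ℤ) ω) x|) →
      ω ∈ {ω | M₁ < |Real.sqrt n * ‖θhat n ω - θ‖|} ∪ ({ω | (M₂ : ℝ≥0∞) < Q ω} ∪
        {ω | (M₃ : ℝ) * n < ∑ t ∈ Finset.Icc 1 n, Z t ω}) := by
    filter_upwards [hX.ae_equations] with ω ⟨e1, e2, e3⟩ hω
    by_contra hcon
    simp only [Set.mem_union, Set.mem_ofPred_eq, not_or, not_lt] at hcon
    obtain ⟨c1, c2, c3⟩ := hcon
    rw [abs_of_nonneg (by positivity), mul_comm, ← le_div_iff₀ hsn] at c1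
    obtain ⟨hu, huτ⟩ := hball (θhat n ω) (c1.trans_lt hn₂)
    -- `M₁` comes without a sign, but it bounds a norm at this `ω`.
    have hM₁0 : 0 ≤ M₁ / Real.sqrt n := (norm_nonneg _).trans c1
    have hV : ∑ t ∈ Finset.Icc 1 n, R ω * (r ^ t * |ε t ω|) ≤ M₂ := by
      have h0 : ∀ t : ℕ, 0 ≤ r ^ t * |ε t ω| := fun t => by positivity
      have h1 : ENNReal.ofReal (∑ t ∈ Finset.Icc 1 n, R ω * (r ^ t * |ε t ω|)) ≤ (M₂ : ℝ≥0∞) := by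
        refine le_trans ?_ c2
        rw [← Finset.mul_sum, ENNReal.ofReal_mul (hR0 ω),
          ENNReal.ofReal_sum_of_nonneg fun t _ => h0 t]
        exact mul_le_mul_right (ENNReal.sum_le_tsum _) _
      rw [← ENNReal.ofReal_natCast] at h1
      exact (ENNReal.ofReal_le_ofReal_iff (Nat.cast_nonneg _)).1 h1
    have hsum : ∑ t ∈ Finset.Icc 1 n, |garchResidual (θhat n ω) (fun t => X t ω) t - ε t ω| ≤
        M₂ + M₁ / Real.sqrt n * (M₃ * n) := by
      refine (Finset.sum_le_sum fun t _ => abs_garchResidual_sub_le hlo hρ₁ hu hθΘ hr hr1 hρr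
        (by positivity) (by linarith) huτ e1 e2 e3 t).trans ?_
      rw [Finset.sum_add_distrib, ← Finset.mul_sum (f := fun t : ℕ => Z t ω)]
      refine add_le_add hV (mul_le_mul c1 c3 (Finset.sum_nonneg fun t _ => hZ0 t ω) hM₁0)
    refine absurd hω (not_lt.2 (iSup_le fun x => ?_))
    refine (ENNReal.ofReal_le_ofReal ?_).trans hn₃.le
    refine (abs_kernelDensity_sub_le hC hh n _ _ x).trans ?_
    have hfinal : M₂ + M₁ / Real.sqrt n * (M₃ * n) ≤ Real.sqrt n * (M₂ + M₁ * M₃) := by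
      have h1 : M₁ / Real.sqrt n * (M₃ * n) = Real.sqrt n * (M₁ * M₃) := by
        field_simp
        rw [Real.sq_sqrt hn0.le]
      rw [h1, mul_add]
      gcongr
      exact le_mul_of_one_le_left (Nat.cast_nonneg _) hsn1
    calc C / (n * h n ^ 2) *
          ∑ t ∈ Finset.Icc 1 n, |garchResidual (θhat n ω) (fun t => X t ω) t - ε t ω|
        ≤ C / (n * h n ^ 2) * (Real.sqrt n * (M₂ + M₁ * M₃)) := by
          gcongr
          exact hsum.trans hfinal
      _ = C * (M₂ + M₁ * M₃) / (Real.sqrt n * h n ^ 2) := by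
          field_simp
          rw [Real.sq_sqrt hn0.le]
  calc P _ ≤ P ({ω | M₁ < |Real.sqrt n * ‖θhat n ω - θ‖|} ∪ ({ω | (M₂ : ℝ≥0∞) < Q ω} ∪
        {ω | (M₃ : ℝ) * n < ∑ t ∈ Finset.Icc 1 n, Z t ω})) := measure_mono_ae hsub
    _ ≤ η / 3 + (η / 3 + η / 3) := by
        refine (measure_union_le _ _).trans (add_le_add hn₁ ?_)
        refine (measure_union_le _ _).trans (add_le_add hM₂ ?_)
        exact measure_mul_lt_sum_le hZm hZ0 hZW hM₃0 hM₃ (by omega)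
    _ = η := by rw [← add_assoc, ENNReal.add_thirds]
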